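/- Let $J=\begin{pmatrix}0&-I\\ I&0\end{pmatrix}$ on $\mathbb R^4$, and let $B(x,\lambda)$, $x,\lambda\in\mathbb R$, be real symmetric $4\times4$ matrices depending smoothly on $(x,\lambda)$, such that for every $\lambda$ the limits of $B(x,\lambda)$ as $x\to+\infty$ and as $x\to-\infty$ exist and equal the same matrix $B_\infty(\lambda)$. Put $A=J^{-1}B$, $A_\infty=J^{-1}B_\infty$, and consider the linear Hamiltonian system $u_x=A(x,\lambda)u$ with fundamental solution $\Phi(x,s,\lambda)$, $\Phi(s,s,\lambda)=I$. Let $$E^{s}(x_0,\lambda)=\{u:\lim_{x\to+\infty}\Phi(x,x_0,\lambda)u=0\},\qquad E^{u}(x_0,\lambda)=\{u:\lim_{x\to-\infty}\Phi(x,x_0,\lambda)u=0\},$$ $$E^s_\infty(\lambda)=\{u:\lim_{x\to+\infty}e^{xA_\infty(\lambda)}u=0\},\qquad E^u_\infty(\lambda)=\{u:\lim_{x\to-\infty}e^{xA_\infty(\lambda)}u=0\}.$$ Let $\lambda\in\mathbb R$ lie outside the essential spectrum, i.e. $A_\infty(\lambda)$ has no eigenvalue on the imaginary axis, and suppose that $\lambda$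 is not an eigenvalue, i.e. $E^s(x,\lambda)\cap E^u(x,\lambda)=\{0\}$ for all $x$. (1) $\mathbb R^4=E^u_\infty(\lambda)\oplus E^s_\infty(\lambda)$; as $x\to-\infty$ and as $x\to+\infty$, the subspace $E^u(x,\lambda)$ converges to $E^u_\infty(\lambda)$ (in the sense of convergence of orthogonal projections); and all crossings, that is, all $x_0\in\mathbb R$ with $E^u(x_0,\lambda)\cap E^s_\infty(\lambda)\neq\{0\}$, lie in a compact interval. (2) Assume that every crossing $x_0$ is regular: $E^u(x_0,\lambda)\cap E^s_\infty(\lambda)$ is spanned by one vector $\xi_{x_0}\ne0$, and $\langle\xi_{x_0},B(x_0,\lambda)\xi_{x_0}\rangle\neq0$. Then there are only finitely many crossings, so that the Maslov index of the path $x\mapsto E^u(x,\lambda)$ relative to $E^s_\infty(\lambda)$, $$\mathrm{Maslov}(\lambda)=\sum_{x_0}\operatorname{sign}\,\langle \xi_{x_0},B(x_0,\lambda)\xi_{x_0}\rangle ,$$ the sum being over all crossings $x_0\in\mathbb R$, is a well-defined (finite) integer, independent of the choice of the $\xi_{x_0}$. -/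

import Mathlib

open Filter Topology
open scoped ContDiff

noncomputable section

namespace SolitaryMaslov

/-- The phase space `ℝ⁴ = ℝ² × ℝ²` with its Euclidean structure. -/
abbrev Phase : Type := EuclideanSpace ℝ (Fin 2 ⊕ Fin 2)

/-- Real `4 × 4` matrices, in `2 × 2` blocks. -/
abbrev Mat4 : Type := Matrix (Fin 2 ⊕ Fin 2) (Fin 2 ⊕ Fin 2) ℝ

/-- A matrix as a linear operator on `ℝ⁴`. -/
def op (M : Mat4) : Phase →L[ℝ] Phase := Matrix.toEuclideanCLM (𝕜 := ℝ) M

/-- `A = J⁻¹ B`, where `J = [[0, -I], [I, 0]]` (this is Mathlib's `Matrix.J`). -/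
def hamMatrix (B : Mat4) : Mat4 := (Matrix.J (Fin 2) ℝ)⁻¹ * B

/-- `u` is a solution on the whole line of `J u_x = B(x) u`, that is, of `u_x = A(x) u`. -/
def IsSolution (B : ℝ → Mat4) (u : ℝ → Phase) : Prop :=
  ∀ x, HasDerivAt u (op (hamMatrix (B x)) (u x)) x

theorem isSolution_zero (B : ℝ → Mat4) : IsSolution B (fun _ => 0) := fun x => by
  simpa using hasDerivAt_const x (0 : Phase)

theorem IsSolution.add {B : ℝ → Mat4} {u v : ℝ → Phase}
    (hu : IsSolution B u) (hv : IsSolution B v) : IsSolution B (fun x => u x + v x) :=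
  fun x => by
    rw [map_add]
    exact (hu x).add (hv x)

theorem IsSolution.smul {B : ℝ → Mat4} {u : ℝ → Phase} (c : ℝ)
    (hu : IsSolution B u) : IsSolution B (fun x => c • u x) :=
  fun x => by
    rw [map_smul]
    exact (hu x).const_smul c

/-- The values at `x₀` of the solutions that tend to `0` along the filter `l`. -/
def decaySpace (B : ℝ → Mat4) (l : Filter ℝ) (x₀ : ℝ) : Submodule ℝ Phase where
  carrier := {p | ∃ u : ℝ → Phase, IsSolution B u ∧ u x₀ = p ∧ Tendsto u l (𝓝 0)}
  zero_mem' := ⟨fun _ => 0, isSolution_zero B, rfl, tendsto_const_nhds⟩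
  add_mem' := by
    rintro _ _ ⟨u, hu, rfl, hu0⟩ ⟨v, hv, rfl, hv0⟩
    exact ⟨fun x => u x + v x, hu.add hv, rfl, by simpa using hu0.add hv0⟩
  smul_mem' := by
    rintro c _ ⟨u, hu, rfl, hu0⟩
    exact ⟨fun x => c • u x, hu.smul c, rfl, by simpa using hu0.const_smul c⟩

/-- `Eˢ(x₀)`: the solution through the point at `x₀` tends to `0` as `x → +∞`. -/
def stableSpace (B : ℝ → Mat4) (x₀ : ℝ) : Submodule ℝ Phase := decaySpace B atTop x₀

/-- `Eᵘ(x₀)`: the solution through the point at `x₀` tends to `0` as `x → -∞`. -/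
def unstableSpace (B : ℝ → Mat4) (x₀ : ℝ) : Submodule ℝ Phase := decaySpace B atBot x₀

/-- The vectors `p` with `exp (x A∞) p → 0` along the filter `l`, where `A∞ = J⁻¹ B∞`. -/
def asymptoticSpace (Binf : Mat4) (l : Filter ℝ) : Submodule ℝ Phase where
  carrier := {p | Tendsto (fun x : ℝ => NormedSpace.exp (x • op (hamMatrix Binf)) p) l (𝓝 0)}
  zero_mem' := by
    rw [Set.mem_ofPred_eq]
    simp only [map_zero]
    exact tendsto_const_nhds
  add_mem' := by
    intro p q hp hq
    rw [Set.mem_ofPred_eq] at hp hq ⊢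
    simpa using hp.add hq
  smul_mem' := by
    intro c p hp
    rw [Set.mem_ofPred_eq] at hp ⊢
    simpa using hp.const_smul c

/-- `Eˢ∞`, the stable subspace of `A∞ = J⁻¹ B∞`. -/
def asymptoticStable (Binf : Mat4) : Submodule ℝ Phase := asymptoticSpace Binf atTop

/-- `Eᵘ∞`, the unstable subspace of `A∞ = J⁻¹ B∞`. -/
def asymptoticUnstable (Binf : Mat4) : Submodule ℝ Phase := asymptoticSpace Binf atBot

/-- The real part of the essential spectrum: the real `lam` for which `A∞(lam)` has a purely
imaginary eigenvalue `iκ` (zero included). -/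
def essentialSpectrum (Binf : ℝ → Mat4) : Set ℝ :=
  {lam | ∃ κ : ℝ, ((hamMatrix (Binf lam)).map (algebraMap ℝ ℂ)
    - (Complex.I * (κ : ℂ)) • (1 : Matrix (Fin 2 ⊕ Fin 2) (Fin 2 ⊕ Fin 2) ℂ)).det = 0}

/-- The parameter `lam` (outside the essential spectrum) is an eigenvalue of the family
`J u_x = B(x, lam) u` if the stable and the unstable solutions intersect nontrivially. -/
def IsEigenvalue (B : ℝ → ℝ → Mat4) (lam : ℝ) : Prop :=
  ∃ x, stableSpace (fun y => B y lam) x ⊓ unstableSpace (fun y => B y lam) x ≠ ⊥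

/-- The intersection `Eᵘ(x) ∩ Eˢ∞`. -/
def crossingSpace (B : ℝ → Mat4) (Binf : Mat4) (x : ℝ) : Submodule ℝ Phase :=
  unstableSpace B x ⊓ asymptoticStable Binf

/-- The points `x` at which `Eᵘ(x)` meets `Eˢ∞` nontrivially. -/
def crossings (B : ℝ → Mat4) (Binf : Mat4) : Set ℝ :=
  {x | crossingSpace B Binf x ≠ ⊥}

/-- The crossing form `⟨ξ, B(x) ξ⟩` (its coefficient with respect to the standard volume form). -/
def crossingForm (B : ℝ → Mat4) (x : ℝ) (ξ : Phase) : ℝ := inner ℝ ξ (op (B x) ξ)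

/-- A regular (simple) intersection: one-dimensional, with crossing form of sign `±1`. -/
def IsRegularCrossing (B : ℝ → Mat4) (Binf : Mat4) (x : ℝ) : Prop :=
  Module.finrank ℝ (crossingSpace B Binf x) = 1 ∧
    ∀ ξ ∈ crossingSpace B Binf x, ξ ≠ 0 → crossingForm B x ξ ≠ 0

/-- `m` is the Maslov index of `Eᵘ(·)` relative to `Eˢ∞`: there are finitely many crossings, and `m`
is the sum over the crossings `x₀` of the signs of `⟨ξ, B(x₀) ξ⟩`, where `ξ` spans
`Eᵘ(x₀) ∩ Eˢ∞`. -/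
def IsMaslovIndex (B : ℝ → Mat4) (Binf : Mat4) (m : ℤ) : Prop :=
  ∃ (hfin : (crossings B Binf).Finite) (ξ : ℝ → Phase),
    (∀ x ∈ crossings B Binf, ξ x ≠ 0 ∧ Submodule.span ℝ {ξ x} = crossingSpace B Binf x) ∧
    m = ∑ x ∈ hfin.toFinset, (SignType.sign (crossingForm B x (ξ x)) : ℤ)

end SolitaryMaslov

end

/-!
Write `A(x) = J⁻¹ B(x)`, with limit `A∞` at both ends, and let `U` be the fundamental solution
normalised at `0` (`exists_isFundamental`). Then `Eᵘ(x)` is the image under `U x` of the fixed space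
`D` of initial values of the solutions decaying at `-∞`.

*Splitting.* Over `ℂ` the space is spanned by generalized eigenvectors of `A∞`, and each of them
decays under `exp (t A∞)` in one time direction, since no eigenvalue is imaginary; taking real parts
shows that `Eᵘ∞` and `Eˢ∞` span (`sup_decayingData_expFlow`). They are disjoint, because some
`exp (T A∞)` halves all norms on `Eˢ∞` (`disjoint_decayingData_expFlow`).

*Convergence.* Instead of exponential dichotomies, quadratic Lyapunov functions are used. For every
`ε > 0` there is a form `Q` whose derivative along `A∞` is positive definite and whose nonnegative
cone contains `Eᵘ∞`, meets `Eˢ∞` only in `0`, and lies within relative distance `ε` of `Eᵘ∞`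
(`exists_isAdapted`). For `|x|` large `Q` also increases along the solutions of `u' = A(x) u`.
Consequently a solution decaying at `-∞` lies in the cone for `x` near `-∞`; and a solution which
does not decay at `+∞` enters the cone and stays there (`StrictLyapunov.tendsto_zero`), uniformly on
the unit sphere of any space of such solutions (`StrictLyapunov.eventually_pos`). As `lam` is not an
eigenvalue, `Eᵘ(x)` lies in the cone near both ends. The same facts, used in reversed time, give
`dim Eᵘ(x) = dim Eᵘ∞` (`finrank_decayingData_atBot`), and subspaces of equal dimension in ever
thinner cones around `Eᵘ∞` have converging orthogonal projections (`tendsto_starProjection`). A cone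
transversal to `Eˢ∞` also excludes crossings near `±∞`.

*Finiteness.* The symplectic form of two solutions is constant, so decaying solutions span isotropic
spaces. An accumulation point of crossings would be a crossing with a vector `ξ ≠ 0` on which the
crossing form vanishes (`crossings_finite`). The sign of the crossing form does not depend on the
choice of the spanning vector, so the Maslov index is well defined.
-/

namespace SolitaryMaslov

/-! ### Linear differential equations on the line -/

open scoped BoundedContinuousFunction

theorem abs_integral_exp_mul_abs_le {c : ℝ} (hc : 0 < c) (x : ℝ) :
    |∫ s in (0 : ℝ)..x, Real.exp (c * |s|)| ≤ Real.exp (c * |x|) / c := by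
  have key : ∀ y : ℝ, 0 ≤ y →
      |∫ s in (0 : ℝ)..y, Real.exp (c * |s|)| ≤ Real.exp (c * |y|) / c := by
    intro y hy
    have h1 : ∫ s in (0 : ℝ)..y, Real.exp (c * |s|) = (Real.exp (c * y) - 1) / c := by
      have : ∫ s in (0 : ℝ)..y, Real.exp (c * |s|) = ∫ s in (0 : ℝ)..y, Real.exp (c * s) := by
        refine intervalIntegral.integral_congr fun s hs => ?_
        rw [Set.uIcc_of_le hy] at hs
        simp only [abs_of_nonneg hs.1]
      rw [this, intervalIntegral.integral_comp_mul_left (fun s => Real.exp s) hc.ne']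
      simp [div_eq_inv_mul]
    rw [h1, abs_of_nonneg hy, abs_of_nonneg]
    · gcongr
      linarith
    · have : 1 ≤ Real.exp (c * y) := Real.one_le_exp (by positivity)
      exact div_nonneg (by linarith) hc.le
  rcases le_total 0 x with hx | hx
  · exact key x hx
  · have h := key (-x) (by linarith)
    have h2 : ∫ s in (0 : ℝ)..x, Real.exp (c * |s|)
        = - ∫ s in (0 : ℝ)..(-x), Real.exp (c * |s|) := by
      have := intervalIntegral.integral_comp_neg (a := 0) (b := x)
        (fun s : ℝ => Real.exp (c * |s|))
      simp only [abs_neg, neg_zero] at this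
      rw [this, ← intervalIntegral.integral_symm]
    rw [h2, abs_neg]
    simpa using h

section LinearODE

variable {F : Type*} [NormedAddCommGroup F] [NormedSpace ℝ F] [CompleteSpace F]

/-- A linear equation with bounded continuous coefficients has a solution on the whole line: the
Picard operator is a contraction for the weighted norm `sup ‖exp (-c|x|) u(x)‖` with `c` large. -/
theorem exists_linear_ode_solution {L : ℝ → F →L[ℝ] F} (hL : Continuous L) {K : ℝ}
    (hK : ∀ x, ‖L x‖ ≤ K) (p : F) :
    ∃ u : ℝ → F, u 0 = p ∧ ∀ x, HasDerivAt u (L x (u x)) x := by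
  have hK0 : 0 ≤ K := (norm_nonneg _).trans (hK 0)
  set c : ℝ := 2 * K + 1 with hc
  have hc0 : 0 < c := by positivity
  -- the integrand, in terms of the weighted unknown `v`
  let g : (ℝ →ᵇ F) → ℝ → F := fun v s => L s (Real.exp (c * |s|) • v s)
  have hg : ∀ v, Continuous (g v) := fun v => by
    have := v.continuous
    exact hL.clm_apply (by fun_prop)
  have hsub : ∀ v w x, ‖∫ s in (0 : ℝ)..x, (g v s - g w s)‖
      ≤ K * ‖v - w‖ * (Real.exp (c * |x|) / c) := by
    intro v w x
    have h1 : ∀ s, ‖g v s - g w s‖ ≤ K * ‖v - w‖ * Real.exp (c * |s|) := by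
      intro s
      have : g v s - g w s = L s (Real.exp (c * |s|) • (v - w) s) := by
        simp [g, ← map_sub, ← smul_sub]
      rw [this]
      refine ((L s).le_opNorm _).trans ?_
      rw [norm_smul, Real.norm_of_nonneg (Real.exp_pos _).le]
      have h2 := (v - w).norm_coe_le_norm s
      calc ‖L s‖ * (Real.exp (c * |s|) * ‖(v - w) s‖)
          ≤ K * (Real.exp (c * |s|) * ‖v - w‖) := by
            gcongr
            exact hK s
        _ = _ := by ring
    have hi : IntervalIntegrable (fun s => K * ‖v - w‖ * Real.exp (c * |s|))
        MeasureTheory.volume 0 x :=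
      Continuous.intervalIntegrable (by fun_prop) _ _
    refine (intervalIntegral.norm_integral_le_abs_of_norm_le (.of_forall fun s => h1 s) hi).trans ?_
    rw [intervalIntegral.integral_const_mul, abs_mul, abs_of_nonneg (by positivity)]
    gcongr
    exact abs_integral_exp_mul_abs_le hc0 x
  have hg0 : g 0 = fun _ => 0 := by
    funext s; simp [g]
  have hint : ∀ v x, ‖∫ s in (0 : ℝ)..x, g v s‖ ≤ K * ‖v‖ * (Real.exp (c * |x|) / c) := by
    intro v x
    simpa [hg0] using hsub v 0 x
  have hexp : ∀ x, Real.exp (-(c * |x|)) * Real.exp (c * |x|) = 1 := fun x => by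
    rw [← Real.exp_add]; simp
  let T : (ℝ →ᵇ F) → (ℝ →ᵇ F) := fun v =>
    BoundedContinuousFunction.ofNormedAddCommGroup
      (fun x => Real.exp (-(c * |x|)) • (p + ∫ s in (0 : ℝ)..x, g v s))
      (by
        have h := intervalIntegral.continuous_primitive
          (fun a b => (hg v).intervalIntegrable (μ := MeasureTheory.volume) a b) 0
        fun_prop)
      (‖p‖ + K * ‖v‖ / c)
      (by
        intro x
        rw [norm_smul, Real.norm_of_nonneg (Real.exp_pos _).le]
        have h1 : Real.exp (-(c * |x|)) ≤ 1 := Real.exp_le_one_iff.2 (by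
          have := abs_nonneg x
          have : 0 ≤ c * |x| := by positivity
          linarith)
        calc Real.exp (-(c * |x|)) * ‖p + ∫ s in (0 : ℝ)..x, g v s‖
            ≤ Real.exp (-(c * |x|)) * (‖p‖ + K * ‖v‖ * (Real.exp (c * |x|) / c)) := by
              gcongr
              exact (norm_add_le _ _).trans (add_le_add le_rfl (hint v x))
          _ = Real.exp (-(c * |x|)) * ‖p‖
              + K * ‖v‖ / c * (Real.exp (-(c * |x|)) * Real.exp (c * |x|)) := by ring
          _ ≤ ‖p‖ + K * ‖v‖ / c := by
              rw [hexp, mul_one]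
              gcongr
              exact mul_le_of_le_one_left (norm_nonneg _) h1)
  have hT : ContractingWith (1 / 2) T := by
    refine ⟨by rw [← NNReal.coe_lt_coe]; norm_num, LipschitzWith.of_dist_le_mul fun v w => ?_⟩
    rw [BoundedContinuousFunction.dist_le (by positivity)]
    intro x
    have h1 : T v x - T w x = Real.exp (-(c * |x|)) • ∫ s in (0 : ℝ)..x, (g v s - g w s) := by
      rw [intervalIntegral.integral_sub ((hg v).intervalIntegrable _ _)
        ((hg w).intervalIntegrable _ _)]
      simp only [T, BoundedContinuousFunction.coe_ofNormedAddCommGroup]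
      rw [← smul_sub]
      congr 1
      abel
    rw [dist_eq_norm, h1, norm_smul, Real.norm_of_nonneg (Real.exp_pos _).le, dist_eq_norm]
    calc Real.exp (-(c * |x|)) * ‖∫ s in (0 : ℝ)..x, (g v s - g w s)‖
        ≤ Real.exp (-(c * |x|)) * (K * ‖v - w‖ * (Real.exp (c * |x|) / c)) := by
          gcongr
          exact hsub v w x
      _ = (K / c) * ‖v - w‖ * (Real.exp (-(c * |x|)) * Real.exp (c * |x|)) := by ring
      _ ≤ (1 / 2) * ‖v - w‖ := by
          rw [hexp, mul_one]
          refine mul_le_mul_of_nonneg_right ?_ (norm_nonneg _)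
          rw [div_le_iff₀ hc0, hc]
          linarith
      _ = _ := by simp
  set v := ContractingWith.fixedPoint T hT with hv
  have hfix : ∀ x, v x = Real.exp (-(c * |x|)) • (p + ∫ s in (0 : ℝ)..x, g v s) := fun x => by
    have h := DFunLike.congr_fun (ContractingWith.fixedPoint_isFixedPt (f := T) hT) x
    exact h.symm
  have hu : ∀ x, Real.exp (c * |x|) • v x = p + ∫ s in (0 : ℝ)..x, g v s := fun x => by
    rw [hfix x, smul_smul, mul_comm, hexp, one_smul]
  refine ⟨fun x => p + ∫ s in (0 : ℝ)..x, g v s, by simp, fun x => ?_⟩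
  have h1 := (intervalIntegral.integral_hasDerivAt_right
    ((hg v).intervalIntegrable (μ := MeasureTheory.volume) 0 x)
    ((hg v).stronglyMeasurableAtFilter _ _) (hg v).continuousAt).const_add p
  have h2 : g v x = L x (p + ∫ s in (0 : ℝ)..x, g v s) := by
    rw [← hu x]
  exact h2 ▸ h1

end LinearODE

theorem linear_ode_unique {F : Type*} [NormedAddCommGroup F] [NormedSpace ℝ F]
    {L : ℝ → F →L[ℝ] F} {K : ℝ}
    (hK : ∀ x, ‖L x‖ ≤ K) {u v : ℝ → F} (hu : ∀ x, HasDerivAt u (L x (u x)) x)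
    (hv : ∀ x, HasDerivAt v (L x (v x)) x) {x₀ : ℝ} (h : u x₀ = v x₀) : u = v := by
  have hK0 : 0 ≤ K := (norm_nonneg _).trans (hK 0)
  refine ODE_solution_unique_univ (v := fun x => L x) (s := fun _ => Set.univ) (K := ⟨K, hK0⟩)
    (t₀ := x₀) (fun x => ?_) (fun x => ⟨hu x, trivial⟩) (fun x => ⟨hv x, trivial⟩) h
  refine ((L x).lipschitz.weaken ?_).lipschitzOnWith
  exact hK x

section Fundamental

variable {E : Type*} [NormedAddCommGroup E] [NormedSpace ℝ E]

/-- `U` is the fundamental solution of `u' = A u` normalised at `0`. -/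
structure IsFundamental (A U : ℝ → E →L[ℝ] E) : Prop where
  zero : U 0 = 1
  hasDerivAt : ∀ x, HasDerivAt U (A x * U x) x

theorem exists_isFundamental [CompleteSpace E] {A : ℝ → E →L[ℝ] E} (hA : Continuous A) {K : ℝ}
    (hK : ∀ x, ‖A x‖ ≤ K) : ∃ U, IsFundamental A U := by
  have hK0 : 0 ≤ K := (norm_nonneg _).trans (hK 0)
  obtain ⟨U, h0, hU⟩ := exists_linear_ode_solution (F := E →L[ℝ] E)
    (L := fun x => ContinuousLinearMap.mul ℝ (E →L[ℝ] E) (A x))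
    ((ContinuousLinearMap.mul ℝ (E →L[ℝ] E)).continuous.comp hA) (K := K)
    (fun x => (ContinuousLinearMap.opNorm_mul_apply_le ℝ _ (A x)).trans (hK x)) 1
  exact ⟨U, h0, fun x => hU x⟩

/-- The initial values `c` of the orbits `x ↦ U x c` that tend to `0` along `l`. -/
def decayingData (U : ℝ → E →L[ℝ] E) (l : Filter ℝ) : Submodule ℝ E where
  carrier := {c | Tendsto (fun x => U x c) l (𝓝 0)}
  zero_mem' := by simpa using tendsto_const_nhds
  add_mem' := fun {a b} ha hb => by simpa using Tendsto.add ha hb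
  smul_mem' := fun r a ha => by simpa using Tendsto.const_smul ha r

theorem mem_decayingData {U : ℝ → E →L[ℝ] E} {l : Filter ℝ} {c : E} :
    c ∈ decayingData U l ↔ Tendsto (fun x => U x c) l (𝓝 0) := Iff.rfl

namespace IsFundamental

variable {A U : ℝ → E →L[ℝ] E}

theorem hasDerivAt_apply (hU : IsFundamental A U) (c : E) (x : ℝ) :
    HasDerivAt (fun y => U y c) (A x (U x c)) x := by
  simpa using (hU.hasDerivAt x).clm_apply (hasDerivAt_const x c)

theorem continuous (hU : IsFundamental A U) : Continuous U :=
  continuous_iff_continuousAt.2 fun x => (hU.hasDerivAt x).continuousAt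

theorem eq_apply (hU : IsFundamental A U) {K : ℝ} (hK : ∀ x, ‖A x‖ ≤ K) {u : ℝ → E}
    (hu : ∀ x, HasDerivAt u (A x (u x)) x) : u = fun x => U x (u 0) :=
  linear_ode_unique hK hu (hU.hasDerivAt_apply _) (x₀ := 0) (by simp [hU.zero])

theorem injective (hU : IsFundamental A U) {K : ℝ} (hK : ∀ x, ‖A x‖ ≤ K) (x : ℝ) :
    Function.Injective (U x) := by
  refine (injective_iff_map_eq_zero _).2 fun c hc => ?_
  have h := linear_ode_unique hK (hU.hasDerivAt_apply c) (v := fun _ => 0)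
    (fun y => by simpa using hasDerivAt_const y (0 : E)) (x₀ := x) hc
  simpa [hU.zero] using congrFun h 0

theorem reverse (hU : IsFundamental A U) :
    IsFundamental (fun x => -A (-x)) (fun x => U (-x)) :=
  ⟨by simpa using hU.zero, fun x => by
    have h := (hU.hasDerivAt (-x)).scomp x (hasDerivAt_neg x)
    simpa [Function.comp_def] using h⟩

end IsFundamental

theorem decayingData_reverse (U : ℝ → E →L[ℝ] E) :
    decayingData (fun x => U (-x)) atTop = decayingData U atBot := by
  ext c
  simp only [mem_decayingData]
  constructor <;> intro h
  · simpa [Function.comp_def] using h.comp tendsto_neg_atBot_atTop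
  · exact h.comp tendsto_neg_atTop_atBot

end Fundamental

/-! ### Strict Lyapunov functions -/

section Lyapunov

variable {E : Type*} [NormedAddCommGroup E] [InnerProductSpace ℝ E]

/-- The derivative of `v ↦ ⟪v, H v⟫` along the linear field `A`. -/
def lieForm (A H : E →L[ℝ] E) (v : E) : ℝ := inner ℝ (A v) (H v) + inner ℝ v (H (A v))

theorem hasDerivAt_quadratic {H : E →L[ℝ] E} {u : ℝ → E} {u' : E} {x : ℝ}
    (hu : HasDerivAt u u' x) :
    HasDerivAt (fun y => inner ℝ (u y) (H (u y)))
      (inner ℝ u' (H (u x)) + inner ℝ (u x) (H u')) x := by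
  have h := hu.inner ℝ (H.hasFDerivAt.comp_hasDerivAt x hu)
  rw [add_comm] at h
  exact h

theorem abs_inner_apply_le (H : E →L[ℝ] E) (v : E) : |inner ℝ v (H v)| ≤ ‖H‖ * ‖v‖ ^ 2 := by
  calc |inner ℝ v (H v)| ≤ ‖v‖ * ‖H v‖ := abs_real_inner_le_norm _ _
    _ ≤ ‖v‖ * (‖H‖ * ‖v‖) := by gcongr; exact H.le_opNorm v
    _ = _ := by ring

/-- `⟪v, H v⟫` is a strict Lyapunov function for the fields `A x`, `x ≥ X`: its derivative
dominates `κ ‖v‖²`. -/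
def StrictLyapunov (A : ℝ → E →L[ℝ] E) (H : E →L[ℝ] E) (κ X : ℝ) : Prop :=
  ∀ x, X ≤ x → ∀ v, κ * ‖v‖ ^ 2 ≤ lieForm (A x) H v

theorem StrictLyapunov.monotoneOn {A U : ℝ → E →L[ℝ] E} {H : E →L[ℝ] E} {κ X : ℝ}
    (hU : IsFundamental A U) (hκ : 0 ≤ κ) (h : StrictLyapunov A H κ X) (c : E) :
    MonotoneOn (fun x => inner ℝ (U x c) (H (U x c))) (Set.Ici X) := by
  have hd := fun x => hasDerivAt_quadratic (H := H) (hU.hasDerivAt_apply c x)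
  refine monotoneOn_of_deriv_nonneg (convex_Ici X)
    (continuousOn_of_forall_continuousAt fun x _ => (hd x).continuousAt)
    (fun x _ => (hd x).differentiableAt.differentiableWithinAt) fun x hx => ?_
  rw [interior_Ici] at hx
  rw [(hd x).deriv]
  exact le_trans (by positivity) (h x (le_of_lt hx) (U x c))

/-- An orbit on which a strict Lyapunov function stays nonpositive tends to `0`. With
`G = ⟪u, H u⟫ - η ‖u‖²` and `η` small, `G' ≥ -a G`, so that `η ‖u‖² ≤ -G` decays exponentially. -/
theorem StrictLyapunov.tendsto_zero {A U : ℝ → E →L[ℝ] E} {H : E →L[ℝ] E} {κ X K : ℝ}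
    (hU : IsFundamental A U) (hK : ∀ x, ‖A x‖ ≤ K) (hκ : 0 < κ) (h : StrictLyapunov A H κ X)
    {c : E} (hc : ∀ x, X ≤ x → inner ℝ (U x c) (H (U x c)) ≤ 0) :
    Tendsto (fun x => U x c) atTop (𝓝 0) := by
  have hK0 : 0 ≤ K := (norm_nonneg _).trans (hK 0)
  -- `η` is such that `η (‖u‖²)' ≤ (κ / 2) ‖u‖²`, and `a` such that `-a G ≤ (κ / 2) ‖u‖²`
  set η : ℝ := κ / (4 * (K + 1)) with hη
  have hη0 : 0 < η := by positivity
  set a : ℝ := (κ / 2) / (‖H‖ + η) with ha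
  have hHη : 0 < ‖H‖ + η := by positivity
  have ha0 : 0 < a := by positivity
  let G : ℝ → ℝ := fun x => inner ℝ (U x c) (H (U x c)) - η * ‖U x c‖ ^ 2
  have hd : ∀ x, HasDerivAt G
      (lieForm (A x) H (U x c) - η * (2 * inner ℝ (U x c) (A x (U x c)))) x := fun x =>
    (hasDerivAt_quadratic (H := H) (hU.hasDerivAt_apply c x)).sub
      ((hU.hasDerivAt_apply c x).norm_sq.const_mul η)
  have hG' : ∀ x, X ≤ x →
      0 ≤ (lieForm (A x) H (U x c) - η * (2 * inner ℝ (U x c) (A x (U x c)))) + a * G x := by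
    intro x hx
    have h1 := h x hx (U x c)
    have h2 : inner ℝ (U x c) (A x (U x c)) ≤ K * ‖U x c‖ ^ 2 :=
      (le_abs_self _).trans ((abs_inner_apply_le _ _).trans (by gcongr; exact hK x))
    have h3 : -(‖H‖ + η) * ‖U x c‖ ^ 2 ≤ G x := by
      have := neg_le_of_abs_le (abs_inner_apply_le H (U x c))
      simp only [G]
      linarith
    have h4 : a * (-(‖H‖ + η) * ‖U x c‖ ^ 2) ≤ a * G x := by gcongr
    have h5 : a * (‖H‖ + η) = κ / 2 := by rw [ha]; field_simp
    have h6 : η * (2 * inner ℝ (U x c) (A x (U x c))) ≤ η * (2 * (K * ‖U x c‖ ^ 2)) := by gcongr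
    have h7 : η * (2 * K) ≤ κ / 2 := by
      rw [hη, div_mul_eq_mul_div, div_le_iff₀ (by positivity)]
      nlinarith
    have h8 : η * (2 * K) * ‖U x c‖ ^ 2 ≤ κ / 2 * ‖U x c‖ ^ 2 := by gcongr
    have h9 : a * (-(‖H‖ + η) * ‖U x c‖ ^ 2) = - (κ / 2 * ‖U x c‖ ^ 2) := by
      rw [← h5]; ring
    linarith
  have hexp : ∀ x, HasDerivAt (fun y => Real.exp (a * y)) (Real.exp (a * x) * a) x := fun x => by
    simpa using ((hasDerivAt_id x).const_mul a).exp
  have hmono : MonotoneOn (fun x => Real.exp (a * x) * G x) (Set.Ici X) := by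
    have hd2 := fun x => (hexp x).mul (hd x)
    refine monotoneOn_of_deriv_nonneg (convex_Ici X)
      (continuousOn_of_forall_continuousAt fun x _ => (hd2 x).continuousAt)
      (fun x _ => (hd2 x).differentiableAt.differentiableWithinAt) fun x hx => ?_
    rw [interior_Ici] at hx
    have h1 := (hd2 x).deriv
    have h2 := mul_nonneg (Real.exp_pos (a * x)).le (hG' x (le_of_lt hx))
    refine le_of_le_of_eq h2 (Eq.trans ?_ h1.symm)
    ring
  have hbound : ∀ x, X ≤ x →
      ‖U x c‖ ^ 2 ≤ (-(Real.exp (a * X) * G X) / η) * Real.exp (-(a * x)) := by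
    intro x hx
    have h1 := hmono Set.self_mem_Ici hx hx
    simp only at h1
    have h2 : η * ‖U x c‖ ^ 2 ≤ - G x := by
      have := hc x hx
      simp only [G]
      linarith
    have h3 : Real.exp (a * x) * (η * ‖U x c‖ ^ 2) ≤ -(Real.exp (a * X) * G X) := by
      have := mul_le_mul_of_nonneg_left h2 (Real.exp_pos (a * x)).le
      linarith
    rw [Real.exp_neg, div_mul_eq_mul_div, le_div_iff₀ hη0, ← div_eq_mul_inv,
      le_div_iff₀ (Real.exp_pos _)]
    linarith
  have hlim : Tendsto (fun x => (-(Real.exp (a * X) * G X) / η) * Real.exp (-(a * x))) atTop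
      (𝓝 0) := by
    have h1 : Tendsto (fun x : ℝ => a * x) atTop atTop := tendsto_id.const_mul_atTop ha0
    simpa using (Real.tendsto_exp_neg_atTop_nhds_zero.comp h1).const_mul
      (-(Real.exp (a * X) * G X) / η)
  have hsq : Tendsto (fun x => ‖U x c‖ ^ 2) atTop (𝓝 0) :=
    squeeze_zero' (.of_forall fun x => by positivity)
      ((eventually_ge_atTop X).mono hbound) hlim
  rw [tendsto_zero_iff_norm_tendsto_zero]
  simpa using hsq.sqrt

/-- If no nonzero orbit issued from the subspace `W` decays at `+∞`, the whole of `W` is eventually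
carried into the positive cone of a strict Lyapunov function: each orbit enters the cone by
`StrictLyapunov.tendsto_zero` and stays there by monotonicity, and the unit sphere of `W` is
compact. -/
theorem StrictLyapunov.eventually_pos [FiniteDimensional ℝ E] {A U : ℝ → E →L[ℝ] E}
    {H : E →L[ℝ] E} {κ X K : ℝ}
    (hU : IsFundamental A U) (hK : ∀ x, ‖A x‖ ≤ K) (hκ : 0 < κ) (h : StrictLyapunov A H κ X)
    {W : Submodule ℝ E} (hW : Disjoint W (decayingData U atTop)) :
    ∀ᶠ x in atTop, ∀ c ∈ W, c ≠ 0 → 0 < inner ℝ (U x c) (H (U x c)) := by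
  have hmono := fun c => h.monotoneOn hU hκ.le c
  let O : ℕ → Set E := fun n => {c | 0 < inner ℝ (U (X + n) c) (H (U (X + n) c))}
  have hO : ∀ n, IsOpen (O n) := fun n =>
    isOpen_lt continuous_const (by fun_prop)
  have hcomp : IsCompact (Metric.sphere (0 : E) 1 ∩ W) :=
    (isCompact_sphere 0 1).inter_right W.closed_of_finiteDimensional
  obtain ⟨n, hn⟩ := hcomp.elim_directed_cover O hO (by
    rintro c ⟨hc1, hcW⟩
    by_contra hcon
    have hneg : ∀ x, X ≤ x → inner ℝ (U x c) (H (U x c)) ≤ 0 := by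
      intro x hx
      obtain ⟨n, hn⟩ := exists_nat_ge (x - X)
      have h1 : ¬ 0 < inner ℝ (U (X + n) c) (H (U (X + n) c)) := fun h' =>
        hcon (Set.mem_iUnion.2 ⟨n, h'⟩)
      exact (hmono c hx (show X ≤ X + n by linarith [(Nat.cast_nonneg n : (0 : ℝ) ≤ n)])
        (by linarith)).trans (not_lt.1 h1)
    have h0 : c = 0 := (Submodule.disjoint_def.1 hW) c hcW (h.tendsto_zero hU hK hκ hneg)
    simp [h0] at hc1) (by
    refine directed_of_isDirected_le fun m n hmn c hc => ?_
    have hm : (m : ℝ) ≤ n := by exact_mod_cast hmn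
    have hm0 : (0 : ℝ) ≤ m := Nat.cast_nonneg m
    exact lt_of_lt_of_le hc (hmono c (show X ≤ X + m by linarith) (show X ≤ X + n by linarith)
      (by linarith)))
  filter_upwards [eventually_ge_atTop (X + n)] with x hx c hcW hc
  have hn0 : (0 : ℝ) ≤ n := Nat.cast_nonneg n
  have hpos : 0 < ‖c‖ := norm_pos_iff.2 hc
  have hmem : ‖c‖⁻¹ • c ∈ O n := hn ⟨by simp [norm_smul, hpos.ne'], W.smul_mem _ hcW⟩
  have h1 : 0 < inner ℝ (U (X + n) c) (H (U (X + n) c)) := by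
    simp only [O, Set.mem_ofPred_eq, map_smul, inner_smul_left, inner_smul_right] at hmem
    have h2 : 0 ≤ ‖c‖⁻¹ := by positivity
    by_contra hcon
    rw [not_lt] at hcon
    have := mul_nonpos_of_nonneg_of_nonpos h2 (mul_nonpos_of_nonneg_of_nonpos h2 hcon)
    simp only [conj_trivial] at hmem
    linarith
  exact h1.trans_le (hmono c (show X ≤ X + n by linarith) (show X ≤ x by linarith) hx)

theorem lieForm_neg_left (A H : E →L[ℝ] E) (v : E) : lieForm (-A) H v = -lieForm A H v := by
  simp only [lieForm, neg_apply, inner_neg_left, map_neg, inner_neg_right]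
  ring

theorem lieForm_neg_neg (A H : E →L[ℝ] E) (v : E) : lieForm (-A) (-H) v = lieForm A H v := by
  simp [lieForm]

/-- A strict Lyapunov inequality is stable under small perturbations of the field. -/
theorem exists_strictLyapunov {A : ℝ → E →L[ℝ] E} {Ainf H : E →L[ℝ] E} {κ : ℝ} (hκ : 0 < κ)
    (hA : Tendsto A atTop (𝓝 Ainf)) (h : ∀ v, κ * ‖v‖ ^ 2 ≤ lieForm Ainf H v) :
    ∃ X, StrictLyapunov A H (κ / 2) X := by
  have hpos : 0 < κ / (4 * (‖H‖ + 1)) := by positivity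
  obtain ⟨X, hX⟩ := eventually_atTop.1 (Metric.tendsto_nhds.1 hA _ hpos)
  refine ⟨X, fun x hx v => ?_⟩
  have h1 := hX x hx
  rw [dist_eq_norm, lt_div_iff₀ (by positivity)] at h1
  have h2 : lieForm (A x) H v = lieForm Ainf H v
      + (inner ℝ ((A x - Ainf) v) (H v) + inner ℝ v (H ((A x - Ainf) v))) := by
    simp only [lieForm, sub_apply, inner_sub_left, inner_sub_right, map_sub]
    ring
  have h3 : |inner ℝ ((A x - Ainf) v) (H v)| ≤ ‖A x - Ainf‖ * ‖H‖ * ‖v‖ ^ 2 := by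
    calc _ ≤ ‖(A x - Ainf) v‖ * ‖H v‖ := abs_real_inner_le_norm _ _
      _ ≤ (‖A x - Ainf‖ * ‖v‖) * (‖H‖ * ‖v‖) := by
        gcongr <;> exact ContinuousLinearMap.le_opNorm _ _
      _ = _ := by ring
  have h4 : |inner ℝ v (H ((A x - Ainf) v))| ≤ ‖A x - Ainf‖ * ‖H‖ * ‖v‖ ^ 2 := by
    calc _ ≤ ‖v‖ * ‖H ((A x - Ainf) v)‖ := abs_real_inner_le_norm _ _
      _ ≤ ‖v‖ * (‖H‖ * (‖A x - Ainf‖ * ‖v‖)) := by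
        gcongr
        exact (H.le_opNorm _).trans (by gcongr; exact ContinuousLinearMap.le_opNorm _ _)
      _ = _ := by ring
  have h5 : 2 * (‖A x - Ainf‖ * ‖H‖) ≤ κ / 2 := by
    nlinarith [norm_nonneg (A x - Ainf)]
  have h6 : 2 * (‖A x - Ainf‖ * ‖H‖) * ‖v‖ ^ 2 ≤ κ / 2 * ‖v‖ ^ 2 := by gcongr
  have := h v
  rw [h2]
  linarith [neg_le_of_abs_le h3, neg_le_of_abs_le h4]

end Lyapunov

/-! ### The flow of a constant field and its energy forms -/

section Exponential

variable {E : Type*} [NormedAddCommGroup E] [NormedSpace ℝ E]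

/-- The flow `t ↦ exp (t A)` of a constant field; for `A = J⁻¹ B∞` its spaces of
decaying data are, by definition, `asymptoticStable B∞` and `asymptoticUnstable B∞`. -/
noncomputable def expFlow (A : E →L[ℝ] E) (t : ℝ) : E →L[ℝ] E := NormedSpace.exp (t • A)

theorem expFlow_zero (A : E →L[ℝ] E) : expFlow A 0 = 1 := by
  simp [expFlow]

theorem expFlow_neg_left (A : E →L[ℝ] E) (t : ℝ) : expFlow (-A) t = expFlow A (-t) := by
  simp [expFlow]

theorem isFundamental_expFlow [CompleteSpace E] (A : E →L[ℝ] E) :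
    IsFundamental (fun _ => A) (expFlow A) :=
  ⟨expFlow_zero A, fun x => hasDerivAt_exp_smul_const' A x⟩

theorem expFlow_add [CompleteSpace E] (A : E →L[ℝ] E) (s t : ℝ) :
    expFlow A (s + t) = expFlow A s * expFlow A t := by
  simp only [expFlow, add_smul]
  let : NormedAlgebra ℚ (E →L[ℝ] E) := .restrictScalars ℚ ℝ _
  exact NormedSpace.exp_add_of_commute (((Commute.refl A).smul_left s).smul_right t)

theorem expFlow_commute (A : E →L[ℝ] E) {P : E →L[ℝ] E} (h : Commute P A) (t : ℝ) :
    Commute P (expFlow A t) :=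
  (h.smul_right t).exp_right

theorem decayingData_expFlow_neg (A : E →L[ℝ] E) :
    decayingData (expFlow (-A)) atTop = decayingData (expFlow A) atBot := by
  rw [← decayingData_reverse]
  congr 1
  funext x
  exact expFlow_neg_left A x

theorem apply_mem_decayingData_expFlow (A : E →L[ℝ] E) {l : Filter ℝ} {p : E}
    (hp : p ∈ decayingData (expFlow A) l) : A p ∈ decayingData (expFlow A) l := by
  have h : ∀ t, expFlow A t (A p) = A (expFlow A t p) := fun t =>
    DFunLike.congr_fun (expFlow_commute A (Commute.refl A) t).symm.eq p
  simp only [mem_decayingData, h] at hp ⊢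
  simpa [Function.comp_def] using (A.continuous.tendsto 0).comp hp

theorem expFlow_mem_decayingData [CompleteSpace E] (A : E →L[ℝ] E) {l : Filter ℝ} {p : E} (t : ℝ)
    (hp : p ∈ decayingData (expFlow A) l) : expFlow A t p ∈ decayingData (expFlow A) l := by
  have h : ∀ s, expFlow A s (expFlow A t p) = expFlow A t (expFlow A s p) := fun s => by
    rw [← mul_apply_eq_comp, ← expFlow_add, add_comm, expFlow_add]
    rfl
  simp only [mem_decayingData, h] at hp ⊢
  simpa [Function.comp_def] using ((expFlow A t).continuous.tendsto 0).comp hp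

end Exponential

section Forms

variable {E : Type*} [NormedAddCommGroup E] [InnerProductSpace ℝ E] [FiniteDimensional ℝ E]

/-- Pointwise decay on a finite-dimensional space is uniform: some `exp (T A)` halves the norm of
every vector with decaying forward orbit. -/
theorem exists_expFlow_contracts (A : E →L[ℝ] E) :
    ∃ T : ℝ, 0 < T ∧ ∀ p ∈ decayingData (expFlow A) atTop, ‖expFlow A T p‖ ≤ (1 / 2) * ‖p‖ := by
  set S := decayingData (expFlow A) atTop
  obtain ⟨C, hC, hCb⟩ := (Module.finBasis ℝ S).exists_opNorm_le (F := E)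
  have hev : ∀ᶠ t : ℝ in atTop, ∀ i, ‖expFlow A t (Module.finBasis ℝ S i : E)‖ ≤ 1 / (2 * C) := by
    rw [eventually_all]
    intro i
    have h := (tendsto_zero_iff_norm_tendsto_zero.1
      (mem_decayingData.1 (Module.finBasis ℝ S i).2)).eventually_le_const
      (u := 1 / (2 * C)) (by positivity)
    exact h
  obtain ⟨T, hT, hT0⟩ := (hev.and (eventually_gt_atTop 0)).exists
  refine ⟨T, hT0, fun p hp => ?_⟩
  have h := hCb (u := (expFlow A T).comp S.subtypeL) (M := 1 / (2 * C)) (by positivity) hT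
  have h2 : C * (1 / (2 * C)) = 1 / 2 := by field_simp
  rw [h2] at h
  exact ((expFlow A T).comp S.subtypeL).le_of_opNorm_le h ⟨p, hp⟩

theorem disjoint_decayingData_expFlow (A : E →L[ℝ] E) :
    Disjoint (decayingData (expFlow A) atBot) (decayingData (expFlow A) atTop) := by
  refine Submodule.disjoint_def.2 fun p hpu hps => ?_
  obtain ⟨T, hT, hTb⟩ := exists_expFlow_contracts A
  have hstep : ∀ n : ℕ,
      ‖expFlow A (-(n * T)) p‖ ≤ (1 / 2) * ‖expFlow A (-((n + 1 : ℕ) * T)) p‖ := by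
    intro n
    have h1 : expFlow A (-(n * T)) p = expFlow A T (expFlow A (-((n + 1 : ℕ) * T)) p) := by
      rw [← mul_apply_eq_comp, ← expFlow_add]
      congr 2
      push_cast
      ring
    rw [h1]
    exact hTb _ (expFlow_mem_decayingData A _ hps)
  have hall : ∀ n : ℕ, ‖p‖ ≤ ‖expFlow A (-(n * T)) p‖ := by
    intro n
    induction n with
    | zero => simp [expFlow_zero]
    | succ n ih =>
      have := hstep n
      have := norm_nonneg (expFlow A (-((n + 1 : ℕ) * T)) p)
      linarith
  have hlim : Tendsto (fun n : ℕ => ‖expFlow A (-(n * T)) p‖) atTop (𝓝 0) := by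
    refine (tendsto_zero_iff_norm_tendsto_zero.1 (mem_decayingData.1 hpu)).comp ?_
    exact tendsto_neg_atTop_atBot.comp (tendsto_natCast_atTop_atTop.atTop_mul_const hT)
  exact norm_le_zero_iff.1 (ge_of_tendsto' hlim hall)

/-- The operator `H` represents the quadratic form `v ↦ ∫₀ᵀ ‖exp (t A) P v‖² dt`, where `P` commutes
with `A`. Along `A` the integrand is differentiated in `t`, so the derivative of the form is a
difference of boundary values. -/
theorem exists_energy_form {A P : E →L[ℝ] E} (hPA : Commute P A) {T : ℝ} (hT : 0 < T) :
    ∃ (H : E →L[ℝ] E) (m : ℝ), 0 < m ∧ (∀ v, m * ‖P v‖ ^ 2 ≤ inner ℝ v (H v)) ∧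
      (∀ v, P v = 0 → inner ℝ v (H v) = 0) ∧
      ∀ v, lieForm A H v = ‖expFlow A T (P v)‖ ^ 2 - ‖P v‖ ^ 2 := by
  let G : ℝ → E →L[ℝ] E := fun t => expFlow A t * P
  have hGc : Continuous G := (isFundamental_expFlow A).continuous.mul continuous_const
  let F : ℝ → E →L[ℝ] E := fun t => (ContinuousLinearMap.adjoint (G t)) * G t
  have hFc : Continuous F :=
    (ContinuousLinearMap.adjoint.continuous.comp hGc).mul hGc
  have hFi : IntervalIntegrable F MeasureTheory.volume 0 T := hFc.intervalIntegrable _ _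
  have hFin : ∀ t v w, inner ℝ v (F t w) = inner ℝ (G t v) (G t w) := fun t v w => by
    simp [F, ContinuousLinearMap.adjoint_inner_right]
  have hH : ∀ v w, inner ℝ v ((∫ t in (0 : ℝ)..T, F t) w)
      = ∫ t in (0 : ℝ)..T, inner ℝ (G t v) (G t w) := fun v w => by
    have h1 := ((innerSL ℝ v).comp (ContinuousLinearMap.apply ℝ E w)).intervalIntegral_comp_comm hFi
    simp only [ContinuousLinearMap.comp_apply, ContinuousLinearMap.apply_apply,
      innerSL_apply_apply, hFin] at h1
    exact h1.symm
  -- the inverse flow is bounded on `[0, T]`, so each `‖exp (t A) P v‖` controls `‖P v‖`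
  obtain ⟨C, hC⟩ := isCompact_Icc.exists_bound_of_continuousOn (s := Set.Icc 0 T)
    ((isFundamental_expFlow A).continuous.comp continuous_neg).continuousOn
  have hC0 : 0 ≤ C := (norm_nonneg _).trans (hC 0 ⟨le_rfl, hT.le⟩)
  refine ⟨∫ t in (0 : ℝ)..T, F t, T * ((C + 1)⁻¹) ^ 2, by positivity, ?_, fun v hv => ?_, ?_⟩
  · intro v
    rw [hH]
    have hlow : ∀ t ∈ Set.Icc 0 T,
        ((C + 1)⁻¹) ^ 2 * ‖P v‖ ^ 2 ≤ inner ℝ (G t v) (G t v) := by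
      intro t ht
      rw [real_inner_self_eq_norm_sq, ← mul_pow]
      gcongr
      have h1 : P v = expFlow A (-t) (G t v) := by
        simp only [G, mul_apply_eq_comp]
        rw [← mul_apply_eq_comp, ← expFlow_add]
        simp [expFlow_zero]
      have h2 : ‖expFlow A (-t)‖ ≤ C + 1 := (hC t ht).trans (by linarith)
      rw [inv_mul_le_iff₀ (by positivity)]
      conv_lhs => rw [h1]
      exact (ContinuousLinearMap.le_opNorm _ _).trans (by gcongr)
    have h1 := intervalIntegral.integral_mono_on hT.le
      (intervalIntegrable_const (μ := MeasureTheory.volume))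
      ((by fun_prop : Continuous fun t => inner ℝ (G t v) (G t v)).intervalIntegrable _ _) hlow
    rw [intervalIntegral.integral_const, sub_zero, smul_eq_mul] at h1
    linarith
  · rw [hH]
    simp [G, hv]
  · intro v
    rw [lieForm, hH]
    have hGA : ∀ t, G t (A v) = A (G t v) := fun t => by
      have h1 : Commute (G t) A := Commute.mul_left (expFlow_commute A (Commute.refl A) t).symm hPA
      exact DFunLike.congr_fun h1.eq v
    rw [hH, ← intervalIntegral.integral_add
      ((by fun_prop : Continuous fun t => inner ℝ (G t (A v)) (G t v)).intervalIntegrable _ _)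
      ((by fun_prop : Continuous fun t => inner ℝ (G t v) (G t (A v))).intervalIntegrable _ _)]
    have hd : ∀ t, HasDerivAt (fun t => ‖G t v‖ ^ 2)
        (inner ℝ (G t (A v)) (G t v) + inner ℝ (G t v) (G t (A v))) t := fun t => by
      have h1 := ((isFundamental_expFlow A).hasDerivAt_apply (P v) t).norm_sq
      rw [hGA, real_inner_comm, ← two_mul]
      exact h1
    rw [intervalIntegral.integral_eq_sub_of_hasDerivAt (fun t _ => hd t)
      ((by fun_prop : Continuous fun t => inner ℝ (G t (A v)) (G t v)
        + inner ℝ (G t v) (G t (A v))).intervalIntegrable _ _)]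
    simp [G, expFlow_zero]

end Forms

/-! ### Decay of generalized eigenvectors -/

section Complexification

open scoped Nat

theorem exp_zero_smul_apply {V : Type*} [NormedAddCommGroup V] [NormedSpace ℂ V]
    (f : V →L[ℂ] V) (v : V) : NormedSpace.exp ((0 : ℝ) • f) v = v := by
  rw [zero_smul, NormedSpace.exp_zero, one_apply_eq_self]

theorem exp_smul_apply_of_pow_eq_zero {V : Type*} [NormedAddCommGroup V] [NormedSpace ℂ V]
    [CompleteSpace V] {f : V →L[ℂ] V} {μ : ℂ} {k : ℕ} {v : V}
    (hv : ((f - μ • 1) ^ k) v = 0) (t : ℝ) :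
    NormedSpace.exp (t • f) v = ∑ j ∈ Finset.range k,
      (Complex.exp (t * μ) * (t ^ j / j ! : ℝ)) • ((f - μ • 1) ^ j) v := by
  set N := f - μ • (1 : V →L[ℂ] V) with hN
  have hf : t • f = algebraMap ℂ (V →L[ℂ] V) (t * μ) + t • N := by
    rw [Algebra.algebraMap_eq_smul_one, hN, smul_sub, mul_smul, Complex.coe_smul]
    abel
  let : NormedAlgebra ℚ (V →L[ℂ] V) := .restrictScalars ℚ ℝ _
  rw [hf, NormedSpace.exp_add_of_commute (Algebra.commutes _ _), ← NormedSpace.algebraMap_exp_comm,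
    ← Complex.exp_eq_exp_ℂ, Algebra.algebraMap_eq_smul_one]
  have hsum : HasSum (fun j => (t ^ j / j ! : ℝ) • (N ^ j) v) (NormedSpace.exp (t • N) v) := by
    have h := NormedSpace.exp_series_hasSum_exp' (𝕂 := ℝ) (t • N)
    have h2 := h.mapL ((ContinuousLinearMap.apply ℂ V v).restrictScalars ℝ)
    convert! h2 using 2 with j
    simp [smul_pow, smul_smul, div_eq_inv_mul]
  have hfin := hsum.unique (hasSum_sum_of_ne_finset_zero (s := Finset.range k) (fun j hj => by
    rw [Finset.mem_range, not_lt] at hj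
    have h0 : (N ^ j) v = 0 := by
      rw [← Nat.sub_add_cancel hj, pow_add, mul_apply_eq_comp, hv, map_zero]
    rw [h0, smul_zero]))
  simp only [mul_apply_eq_comp, smul_apply, one_apply_eq_self, hfin,
    Finset.smul_sum, mul_smul, Complex.coe_smul]

theorem tendsto_exp_smul_apply_of_re_neg {V : Type*} [NormedAddCommGroup V] [NormedSpace ℂ V]
    [CompleteSpace V] {f : V →L[ℂ] V} {μ : ℂ} {k : ℕ} {v : V} (hμ : μ.re < 0)
    (hv : ((f - μ • 1) ^ k) v = 0) :
    Tendsto (fun t : ℝ => NormedSpace.exp (t • f) v) atTop (𝓝 0) := by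
  simp only [exp_smul_apply_of_pow_eq_zero hv]
  rw [← Finset.sum_const_zero (s := Finset.range k)]
  refine tendsto_finsetSum _ fun j _ => ?_
  rw [← zero_smul ℂ (((f - μ • (1 : V →L[ℂ] V)) ^ j) v)]
  refine Tendsto.smul_const ?_ _
  rw [tendsto_zero_iff_norm_tendsto_zero]
  have hr : 0 < -μ.re := by linarith
  have h1 : Tendsto (fun t : ℝ => t ^ j * Real.exp (-(-μ.re) * t)) atTop (𝓝 0) := by
    have h2 := ((Real.tendsto_pow_mul_exp_neg_atTop_nhds_zero j).comp
      (tendsto_id.const_mul_atTop hr)).const_mul (((-μ.re) ^ j)⁻¹)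
    rw [mul_zero] at h2
    refine h2.congr fun t => ?_
    simp only [Function.comp, id, mul_pow]
    rw [← mul_assoc, ← mul_assoc, inv_mul_cancel₀ (by positivity), one_mul]
    ring_nf
  have h3 := h1.norm.div_const (j ! : ℝ)
  simp only [norm_zero, zero_div] at h3
  refine h3.congr fun t => ?_
  rw [norm_mul, norm_mul, Complex.norm_exp, Complex.norm_real, norm_div, Real.norm_of_nonneg
    (Real.exp_pos _).le, Real.norm_of_nonneg (by positivity : (0 : ℝ) ≤ (j ! : ℝ))]
  have : ((t : ℂ) * μ).re = - -μ.re * t := by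
    simp [mul_comm]
  rw [this]
  ring

theorem tendsto_exp_smul_apply_of_re_pos {V : Type*} [NormedAddCommGroup V] [NormedSpace ℂ V]
    [CompleteSpace V] {f : V →L[ℂ] V} {μ : ℂ} {k : ℕ} {v : V} (hμ : 0 < μ.re)
    (hv : ((f - μ • 1) ^ k) v = 0) :
    Tendsto (fun t : ℝ => NormedSpace.exp (t • f) v) atBot (𝓝 0) := by
  have hv' : ((-f - (-μ) • (1 : V →L[ℂ] V)) ^ k) v = 0 := by
    have h : -f - (-μ) • (1 : V →L[ℂ] V) = -(f - μ • 1) := by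
      rw [neg_smul]; abel
    rw [h, neg_pow, mul_apply_eq_comp, hv, map_zero]
  have h := (tendsto_exp_smul_apply_of_re_neg (by simpa using hμ) hv').comp tendsto_neg_atBot_atTop
  simpa only [Function.comp_def, neg_smul, smul_neg, neg_neg] using h

variable {n : Type*} [Fintype n]

/-- The componentwise real part. -/
noncomputable def realPart (n : Type*) [Fintype n] : EuclideanSpace ℂ n →L[ℝ] EuclideanSpace ℝ n :=
  LinearMap.toContinuousLinearMap
    { toFun := fun v => WithLp.toLp 2 fun i => (v i).re
      map_add' := fun v w => by ext i; simp
      map_smul' := fun r v => by ext i; simp }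

theorem realPart_apply (v : EuclideanSpace ℂ n) (i : n) : realPart n v i = (v i).re := rfl

theorem realPart_surjective : Function.Surjective (realPart n) := fun p =>
  ⟨WithLp.toLp 2 fun i => (p i : ℂ), by ext i; simp [realPart_apply]⟩

variable [DecidableEq n]

theorem realPart_toEuclideanCLM (M : Matrix n n ℝ) (v : EuclideanSpace ℂ n) :
    realPart n (Matrix.toEuclideanCLM (𝕜 := ℂ) (M.map (algebraMap ℝ ℂ)) v)
      = Matrix.toEuclideanCLM (𝕜 := ℝ) M (realPart n v) := by
  ext i
  simp [realPart_apply, Matrix.ofLp_toEuclideanCLM, Matrix.mulVec, dotProduct]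

theorem realPart_exp (M : Matrix n n ℝ) (v : EuclideanSpace ℂ n) (t : ℝ) :
    realPart n (NormedSpace.exp (t • Matrix.toEuclideanCLM (𝕜 := ℂ) (M.map (algebraMap ℝ ℂ))) v)
      = expFlow (Matrix.toEuclideanCLM (𝕜 := ℝ) M) t (realPart n v) := by
  set f := Matrix.toEuclideanCLM (𝕜 := ℂ) (M.map (algebraMap ℝ ℂ)) with hf
  have hd : ∀ t : ℝ, HasDerivAt (fun t : ℝ => realPart n (NormedSpace.exp (t • f) v))
      (Matrix.toEuclideanCLM (𝕜 := ℝ) M (realPart n (NormedSpace.exp (t • f) v))) t := by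
    intro t
    have h1 := hasDerivAt_exp_smul_const' (𝕂 := ℝ) f t
    have h2 := ((realPart n).comp
      ((ContinuousLinearMap.apply ℂ _ v).restrictScalars ℝ)).hasFDerivAt.comp_hasDerivAt t h1
    rw [← realPart_toEuclideanCLM]
    exact h2
  have h := (isFundamental_expFlow (Matrix.toEuclideanCLM (𝕜 := ℝ) M)).eq_apply
    (fun _ => le_rfl) hd
  have h0 : NormedSpace.exp ((0 : ℝ) • f) v = v :=
    exp_zero_smul_apply f v
  have ht := congrFun h t
  simp only [h0] at ht
  exact ht

/-- For a real matrix without purely imaginary eigenvalues, the vectors decaying in forward and in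
backward time span the space: `ℂⁿ` is spanned by generalized eigenvectors, each of which decays in
one of the two directions, and real parts of decaying orbits decay. -/
theorem sup_decayingData_expFlow (M : Matrix n n ℝ)
    (hM : ∀ κ : ℝ, (M.map (algebraMap ℝ ℂ)
      - (Complex.I * (κ : ℂ)) • (1 : Matrix n n ℂ)).det ≠ 0) :
    decayingData (expFlow (Matrix.toEuclideanCLM (𝕜 := ℝ) M)) atBot ⊔
      decayingData (expFlow (Matrix.toEuclideanCLM (𝕜 := ℝ) M)) atTop = ⊤ := by
  let V := EuclideanSpace ℂ n
  set A := Matrix.toEuclideanCLM (𝕜 := ℝ) M with hA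
  set Mc := M.map (algebraMap ℝ ℂ) with hMc
  set f := Matrix.toEuclideanCLM (𝕜 := ℂ) Mc with hf
  set D := decayingData (expFlow A) atBot ⊔ decayingData (expFlow A) atTop with hD
  have key : ∀ v : EuclideanSpace ℂ n, realPart n v ∈ D := by
    intro v
    have hv : v ∈ ⨆ μ, Module.End.maxGenEigenspace (f : V →ₗ[ℂ] V) μ := by
      rw [Module.End.iSup_maxGenEigenspace_eq_top]; trivial
    induction hv using Submodule.iSup_induction' with
    | zero => simp
    | add v w _ _ hv hw =>
      rw [map_add]
      exact D.add_mem hv hw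
    | mem μ v hv =>
      obtain ⟨k, hk⟩ := (Module.End.mem_maxGenEigenspace _ _ _).1 hv
      have hk' : ((f - μ • (1 : V →L[ℂ] V)) ^ k) v = 0 := by
        have : (((f - μ • (1 : V →L[ℂ] V)) ^ k :
            V →L[ℂ] V) : V →ₗ[ℂ] V)
            = ((f : V →ₗ[ℂ] V) - μ • 1) ^ k := by
          rw [ContinuousLinearMap.toLinearMap_pow]
          rfl
        rw [← hk, ← this]
        rfl
      rcases lt_trichotomy μ.re 0 with hμ | hμ | hμ
      · refine Submodule.mem_sup_right ?_
        have h := (realPart n).continuous.tendsto 0 |>.comp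
          (tendsto_exp_smul_apply_of_re_neg hμ hk')
        rw [map_zero] at h
        exact h.congr fun t => realPart_exp M v t
      · -- an imaginary `μ` is not an eigenvalue, so its generalized eigenspace is zero
        have hunit : IsUnit (f - μ • (1 : V →L[ℂ] V)) := by
          have h1 : f - μ • (1 : V →L[ℂ] V) = Matrix.toEuclideanCLM (𝕜 := ℂ) (Mc - μ • 1) := by
            rw [map_sub, map_smul, map_one]
          have h2 : μ = Complex.I * (μ.im : ℂ) := by
            apply Complex.ext <;> simp [hμ]
          have h3 : IsUnit (Mc - μ • 1) := by
            rw [Matrix.isUnit_iff_isUnit_det, isUnit_iff_ne_zero, h2]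
            exact hM μ.im
          rw [h1]
          exact h3.map (Matrix.toEuclideanCLM (n := n) (𝕜 := ℂ))
        obtain ⟨w, hw⟩ := hunit.pow k
        have hv0 : v = 0 := by
          have h4 : ((↑w⁻¹ : V →L[ℂ] V) * (↑w : V →L[ℂ] V) : V →L[ℂ] V) v = 0 := by
            rw [mul_apply_eq_comp, hw, hk', map_zero]
          simpa using h4
        simp [hv0]
      · refine Submodule.mem_sup_left ?_
        have h := (realPart n).continuous.tendsto 0 |>.comp
          (tendsto_exp_smul_apply_of_re_pos hμ hk')
        rw [map_zero] at h
        exact h.congr fun t => realPart_exp M v t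
  refine eq_top_iff.2 fun p _ => ?_
  obtain ⟨v, rfl⟩ := realPart_surjective p
  exact key v

end Complexification

/-! ### Convergence of projections and adapted forms -/

section Projections

variable {E : Type*} [NormedAddCommGroup E] [InnerProductSpace ℝ E] [FiniteDimensional ℝ E]

/-- If `V` lies in an `ε`-thin cone around a subspace `W` of the same dimension, the orthogonal
projections are close, because
`P_V - P_W = (1 - P_W) P_V - P_W (1 - P_V)` and both terms are small. -/
theorem norm_starProjection_sub_le {V W : Submodule ℝ E}
    (hdim : Module.finrank ℝ V = Module.finrank ℝ W) {ε : ℝ} (hε0 : 0 ≤ ε) (hε : ε ≤ 1 / 2)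
    (h : ∀ v ∈ V, ∃ w ∈ W, ‖v - w‖ ≤ ε * ‖v‖) :
    ‖V.starProjection - W.starProjection‖ ≤ 3 * ε := by
  have hclose : ∀ v ∈ V, ‖v - W.starProjection v‖ ≤ ε * ‖v‖ := by
    intro v hv
    obtain ⟨w, hw, hvw⟩ := h v hv
    refine le_trans ?_ hvw
    have h1 : v - W.starProjection v = Wᗮ.starProjection (v - w) := by
      rw [Submodule.starProjection_orthogonal_val, map_sub,
        (Submodule.starProjection_eq_self_iff (K := W)).2 hw]
      abel
    rw [h1]
    exact Submodule.norm_starProjection_apply_le _ _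
  -- by the equality of dimensions, every vector of `W` is the projection of a vector of `V`
  have hsurj : ∀ z ∈ W, ∃ v ∈ V, W.starProjection v = z := by
    intro z hz
    let f : V →ₗ[ℝ] W := (W.orthogonalProjectionOnto : E →ₗ[ℝ] W).comp V.subtype
    have hinj : Function.Injective f := by
      refine (injective_iff_map_eq_zero _).2 fun v hv => ?_
      have h0 : W.starProjection (v : E) = 0 := by
        rw [Submodule.starProjection_apply]
        exact congrArg Subtype.val hv
      have h1 := hclose v v.2
      rw [h0, sub_zero] at h1
      have h2 : ‖(v : E)‖ ≤ 0 := by nlinarith [norm_nonneg (v : E)]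
      exact Subtype.ext (norm_le_zero_iff.1 h2)
    obtain ⟨v, hv⟩ := (LinearMap.injective_iff_surjective_of_finrank_eq_finrank hdim).1 hinj ⟨z, hz⟩
    refine ⟨v, v.2, ?_⟩
    rw [Submodule.starProjection_apply]
    exact congrArg Subtype.val hv
  refine ContinuousLinearMap.opNorm_le_bound _ (by positivity) fun x => ?_
  set y := x - V.starProjection x with hy
  have hyn : ‖y‖ ≤ ‖x‖ := by
    rw [hy, ← Submodule.starProjection_orthogonal_val]
    exact Submodule.norm_starProjection_apply_le _ _
  have hdec : (V.starProjection - W.starProjection) x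
      = (V.starProjection x - W.starProjection (V.starProjection x)) - W.starProjection y := by
    rw [hy, map_sub, sub_apply]
    abel
  have h1 : ‖V.starProjection x - W.starProjection (V.starProjection x)‖ ≤ ε * ‖x‖ :=
    (hclose _ (V.starProjection_apply_mem x)).trans
      (by gcongr; exact Submodule.norm_starProjection_apply_le _ _)
  have h2 : ‖W.starProjection y‖ ≤ 2 * ε * ‖x‖ := by
    obtain ⟨v, hv, hvz⟩ := hsurj _ (W.starProjection_apply_mem y)
    set z := W.starProjection y with hz
    have hvz' : ‖v - z‖ ≤ ε * ‖v‖ := hvz ▸ hclose v hv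
    have hv2 : ‖v‖ ≤ 2 * ‖z‖ := by
      have h3 : ‖v‖ ≤ ‖z‖ + ‖v - z‖ := by simpa using norm_add_le z (v - z)
      nlinarith [norm_nonneg v]
    have hzz : inner ℝ z z = inner ℝ (z - v) y := by
      have h3 : inner ℝ (y - z) z = 0 :=
        W.starProjection_inner_eq_zero y z (W.starProjection_apply_mem y)
      have h4 : inner ℝ y v = 0 := V.starProjection_inner_eq_zero x v hv
      rw [inner_sub_left] at h3
      rw [inner_sub_left, real_inner_comm y v, h4, real_inner_comm y z]
      linarith
    have h5 : ‖z‖ ^ 2 ≤ (2 * ε * ‖x‖) * ‖z‖ := by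
      calc ‖z‖ ^ 2 = inner ℝ (z - v) y := by rw [← hzz, real_inner_self_eq_norm_sq]
        _ ≤ ‖z - v‖ * ‖y‖ := real_inner_le_norm _ _
        _ ≤ (ε * (2 * ‖z‖)) * ‖x‖ := by
          rw [norm_sub_rev]
          gcongr
          exact hvz'.trans (by gcongr)
        _ = _ := by ring
    rcases eq_or_lt_of_le (norm_nonneg z) with h0 | h0
    · rw [← h0]; positivity
    · rw [sq] at h5
      exact le_of_mul_le_mul_right h5 h0
  rw [hdec]
  calc _ ≤ ε * ‖x‖ + 2 * ε * ‖x‖ := (norm_sub_le _ _).trans (add_le_add h1 h2)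
    _ = _ := by ring

theorem tendsto_starProjection {ι : Type*} {l : Filter ι} {V : ι → Submodule ℝ E}
    {W : Submodule ℝ E} (hdim : ∀ i, Module.finrank ℝ (V i) = Module.finrank ℝ W)
    (h : ∀ ε : ℝ, 0 < ε → ∀ᶠ i in l, ∀ v ∈ V i, ∃ w ∈ W, ‖v - w‖ ≤ ε * ‖v‖) :
    Tendsto (fun i => (V i).starProjection) l (𝓝 W.starProjection) := by
  refine Metric.tendsto_nhds.2 fun ε hε => ?_
  filter_upwards [h (min (1 / 2) (ε / 4)) (by positivity)] with i hi
  rw [dist_eq_norm]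
  have h1 := norm_starProjection_sub_le (hdim i) (by positivity) (min_le_left _ _) hi
  have h2 := min_le_right (1 / 2) (ε / 4)
  linarith

end Projections

section Cone

variable {E : Type*} [NormedAddCommGroup E] [InnerProductSpace ℝ E] [FiniteDimensional ℝ E]

/-- The projection onto `p` along `q` commutes with an operator leaving both invariant. -/
theorem commute_projection {A : E →L[ℝ] E} {p q : Submodule ℝ E} (h : IsCompl p q)
    (hp : ∀ v ∈ p, A v ∈ p) (hq : ∀ v ∈ q, A v ∈ q) :
    Commute (LinearMap.toContinuousLinearMap (p.projection q h)) A := by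
  ext v
  obtain ⟨a, ha, b, hb, rfl⟩ := Submodule.mem_sup.1
    (show v ∈ p ⊔ q by rw [h.sup_eq_top]; trivial)
  simp [Submodule.projection_apply_of_mem_left h ha, Submodule.projection_apply_of_mem_right h hb,
    Submodule.projection_apply_of_mem_left h (hp a ha),
    Submodule.projection_apply_of_mem_right h (hq b hb)]

/-- A quadratic form `⟪v, H v⟫` is *adapted* to `A` at scale `ε` if it strictly increases along the
flow of `A`, is nonnegative on the unstable space, is negative on the stable space, and if its
nonnegative cone is an `ε`-neighbourhood of the unstable space. -/
structure IsAdapted (A H : E →L[ℝ] E) (κ ε : ℝ) : Prop where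
  pos : 0 < κ
  le_lieForm : ∀ v, κ * ‖v‖ ^ 2 ≤ lieForm A H v
  nonneg : ∀ v ∈ decayingData (expFlow A) atBot, 0 ≤ inner ℝ v (H v)
  eq_zero : ∀ v ∈ decayingData (expFlow A) atTop, 0 ≤ inner ℝ v (H v) → v = 0
  close : ∀ v, 0 ≤ inner ℝ v (H v) →
    ∃ w ∈ decayingData (expFlow A) atBot, ‖v - w‖ ≤ ε * ‖v‖

/-- With `Hᵤ` and `Hₛ` the energy forms of the unstable component (backward in time) and of the
stable component (forward in time), `δ Hᵤ - Hₛ` is adapted at any prescribed scale once `δ` is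
small. -/
theorem exists_isAdapted {A : E →L[ℝ] E}
    (h : IsCompl (decayingData (expFlow A) atBot) (decayingData (expFlow A) atTop))
    {ε : ℝ} (hε : 0 < ε) : ∃ H κ, IsAdapted A H κ ε := by
  set Eu := decayingData (expFlow A) atBot with hEu
  set Es := decayingData (expFlow A) atTop with hEs
  set P : E →L[ℝ] E := LinearMap.toContinuousLinearMap (Es.projection Eu h.symm) with hP
  set Q : E →L[ℝ] E := LinearMap.toContinuousLinearMap (Eu.projection Es h) with hQ
  have hPm : ∀ v, P v ∈ Es := fun v => Submodule.projection_apply_mem _ _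
  have hQm : ∀ v, Q v ∈ Eu := fun v => Submodule.projection_apply_mem _ _
  have hPQ : ∀ v, Q v + P v = v := fun v => Submodule.projection_add_projection_eq_self h v
  have hPs : ∀ v ∈ Es, P v = v := fun v hv => Submodule.projection_apply_of_mem_left h.symm hv
  have hPu : ∀ v ∈ Eu, P v = 0 := fun v hv => Submodule.projection_apply_of_mem_right h.symm hv
  have hQs : ∀ v ∈ Es, Q v = 0 := fun v hv => Submodule.projection_apply_of_mem_right h hv
  have hPA : Commute P A := commute_projection h.symm
    (fun v hv => apply_mem_decayingData_expFlow A hv)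
    (fun v hv => apply_mem_decayingData_expFlow A hv)
  have hQA : Commute Q (-A) := (commute_projection h
    (fun v hv => apply_mem_decayingData_expFlow A hv)
    (fun v hv => apply_mem_decayingData_expFlow A hv)).neg_right
  obtain ⟨T, hT, hTc⟩ := exists_expFlow_contracts A
  obtain ⟨S, hS, hSc⟩ := exists_expFlow_contracts (-A)
  obtain ⟨Hs, m, hm, hHs, hHs0, hHs'⟩ := exists_energy_form hPA hT
  obtain ⟨Hu, k, hk, hHu, hHu0, hHu'⟩ := exists_energy_form hQA hS
  have hs : ∀ v, lieForm A Hs v ≤ -(3 / 4) * ‖P v‖ ^ 2 := fun v => by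
    rw [hHs']
    have h1 := hTc _ (hPm v)
    have h2 : ‖expFlow A T (P v)‖ ^ 2 ≤ ((1 / 2) * ‖P v‖) ^ 2 := by gcongr
    nlinarith
  have hu : ∀ v, (3 / 4) * ‖Q v‖ ^ 2 ≤ lieForm A Hu v := fun v => by
    have h0 := hHu' v
    rw [lieForm_neg_left] at h0
    have h1 := hSc (Q v) (by rw [decayingData_expFlow_neg]; exact hQm v)
    have h2 : ‖expFlow (-A) S (Q v)‖ ^ 2 ≤ ((1 / 2) * ‖Q v‖) ^ 2 := by gcongr
    nlinarith
  -- if `⟪v, (δ Hᵤ - Hₛ) v⟫ ≥ 0`, then `m ‖P v‖² ≤ δ ‖Hᵤ‖ ‖v‖² ≤ m ε² ‖v‖²` for this `δ`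
  set δ : ℝ := min 1 (m * ε ^ 2 / (‖Hu‖ + 1)) with hδ
  have hδ0 : 0 < δ := by positivity
  have hδ1 : δ ≤ 1 := min_le_left _ _
  have hδ2 : δ * (‖Hu‖ + 1) ≤ m * ε ^ 2 := by
    rw [← le_div_iff₀ (by positivity)]
    exact min_le_right _ _
  have hform : ∀ v, inner ℝ v ((δ • Hu - Hs) v) = δ * inner ℝ v (Hu v) - inner ℝ v (Hs v) :=
    fun v => by simp [inner_sub_right, inner_smul_right]
  have hlie : ∀ v, lieForm A (δ • Hu - Hs) v = δ * lieForm A Hu v - lieForm A Hs v := fun v => by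
    simp only [lieForm, sub_apply, smul_apply, inner_sub_right, inner_smul_right]
    ring
  refine ⟨δ • Hu - Hs, 3 / 8 * δ, by positivity, fun v => ?_, fun v hv => ?_, fun v hv h0 => ?_,
    fun v h0 => ?_⟩
  · rw [hlie]
    have h1 : ‖v‖ ^ 2 ≤ 2 * ‖Q v‖ ^ 2 + 2 * ‖P v‖ ^ 2 := by
      have h2 : ‖v‖ ≤ ‖Q v‖ + ‖P v‖ := by
        conv_lhs => rw [← hPQ v]
        exact norm_add_le _ _
      have h3 : ‖v‖ ^ 2 ≤ (‖Q v‖ + ‖P v‖) ^ 2 := by gcongr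
      nlinarith [sq_nonneg (‖Q v‖ - ‖P v‖)]
    have h2 := mul_le_mul_of_nonneg_left (hu v) hδ0.le
    have h3 := mul_le_mul_of_nonneg_left h1 hδ0.le
    have h4 : δ * ‖P v‖ ^ 2 ≤ ‖P v‖ ^ 2 := mul_le_of_le_one_left (by positivity) hδ1
    linarith [hs v]
  · have h1 : (0 : ℝ) ≤ inner ℝ v (Hu v) := le_trans (by positivity) (hHu v)
    have h2 := hHs0 v (hPu v hv)
    rw [hform, h2]
    have := mul_nonneg hδ0.le h1
    linarith
  · rw [hform] at h0
    have h1 := hHs v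
    rw [hPs v hv] at h1
    rw [hHu0 v (hQs v hv)] at h0
    have h2 : m * ‖v‖ ^ 2 ≤ m * 0 := by linarith
    have h3 := le_of_mul_le_mul_left h2 hm
    exact norm_eq_zero.1 (pow_eq_zero_iff two_ne_zero |>.1 (le_antisymm h3 (sq_nonneg _)))
  · rw [hform] at h0
    refine ⟨Q v, hQm v, ?_⟩
    have h1 : v - Q v = P v := by rw [sub_eq_iff_eq_add', hPQ]
    rw [h1]
    have h2 := hHs v
    have h3 : inner ℝ v (Hu v) ≤ ‖Hu‖ * ‖v‖ ^ 2 := (le_abs_self _).trans (abs_inner_apply_le Hu v)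
    have h4 := mul_le_mul_of_nonneg_left h3 hδ0.le
    have h5 := mul_le_mul_of_nonneg_right hδ2 (sq_nonneg ‖v‖)
    have h6 : m * ‖P v‖ ^ 2 ≤ m * (ε * ‖v‖) ^ 2 := by nlinarith [sq_nonneg ‖v‖]
    exact le_of_sq_le_sq (le_of_mul_le_mul_left h6 hm) (by positivity)

end Cone

/-! ### The unstable space near the two ends -/

section Asymptotics

variable {E : Type*} [NormedAddCommGroup E] [InnerProductSpace ℝ E]

theorem StrictLyapunov.nonpos {A U : ℝ → E →L[ℝ] E} {H : E →L[ℝ] E} {κ X : ℝ}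
    (hU : IsFundamental A U) (hκ : 0 ≤ κ) (h : StrictLyapunov A H κ X) {c : E}
    (hc : c ∈ decayingData U atTop) {x : ℝ} (hx : X ≤ x) :
    inner ℝ (U x c) (H (U x c)) ≤ 0 := by
  have hlim : Tendsto (fun y => inner ℝ (U y c) (H (U y c))) atTop (𝓝 0) := by
    have h1 := mem_decayingData.1 hc
    simpa using h1.inner (𝕜 := ℝ) ((H.continuous.tendsto 0).comp h1)
  exact ge_of_tendsto hlim ((eventually_ge_atTop x).mono fun y hy =>
    h.monotoneOn hU hκ c hx (hx.trans hy) hy)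

theorem IsAdapted.exists_strictLyapunov_reverse {A : ℝ → E →L[ℝ] E} {Ainf H : E →L[ℝ] E} {κ ε : ℝ}
    (hH : IsAdapted Ainf H κ ε) (hA : Tendsto A atBot (𝓝 Ainf)) :
    ∃ X, StrictLyapunov (fun x => -A (-x)) (-H) (κ / 2) X :=
  exists_strictLyapunov hH.pos (hA.comp tendsto_neg_atTop_atBot).neg fun v => by
    rw [lieForm_neg_neg]
    exact hH.le_lieForm v

/-- Near `-∞` the unstable space lies in the nonnegative cone of an adapted form, since the form
increases from the value `0` along each orbit decaying at `-∞`. -/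
theorem IsAdapted.eventually_nonneg_atBot {A U : ℝ → E →L[ℝ] E} {Ainf H : E →L[ℝ] E} {κ ε : ℝ}
    (hH : IsAdapted Ainf H κ ε) (hU : IsFundamental A U) (hA : Tendsto A atBot (𝓝 Ainf)) :
    ∀ᶠ x in atBot, ∀ c ∈ decayingData U atBot, 0 ≤ inner ℝ (U x c) (H (U x c)) := by
  obtain ⟨X, hX⟩ := hH.exists_strictLyapunov_reverse hA
  filter_upwards [eventually_le_atBot (-X)] with x hx c hc
  rw [← decayingData_reverse] at hc
  have h := hX.nonpos hU.reverse (half_pos hH.pos).le hc (le_neg_of_le_neg hx)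
  simpa using h

variable [FiniteDimensional ℝ E]

/-- Near `+∞` a space of initial data without nonzero orbits decaying at `+∞` is carried into the
nonnegative cone of an adapted form. -/
theorem IsAdapted.eventually_nonneg_atTop {A U : ℝ → E →L[ℝ] E} {Ainf H : E →L[ℝ] E}
    {κ ε K : ℝ} (hH : IsAdapted Ainf H κ ε) (hU : IsFundamental A U) (hK : ∀ x, ‖A x‖ ≤ K)
    (hA : Tendsto A atTop (𝓝 Ainf)) {W : Submodule ℝ E} (hW : Disjoint W (decayingData U atTop)) :
    ∀ᶠ x in atTop, ∀ c ∈ W, 0 ≤ inner ℝ (U x c) (H (U x c)) := by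
  obtain ⟨X, hX⟩ := exists_strictLyapunov hH.pos hA hH.le_lieForm
  filter_upwards [hX.eventually_pos hU hK (half_pos hH.pos) hW] with x hx c hc
  rcases eq_or_ne c 0 with rfl | h0
  · simp
  · exact (hx c hc h0).le

/-- The orbits decaying at `-∞` form a space of the dimension of the asymptotic unstable space. It
is at most that, because near `-∞` these orbits lie in a cone transversal to the asymptotic stable
space; and it is at least that, because in backward time a complement of this space enters a cone
transversal to the asymptotic unstable space. -/
theorem finrank_decayingData_atBot {A U : ℝ → E →L[ℝ] E} {Ainf : E →L[ℝ] E} {K : ℝ}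
    (hU : IsFundamental A U) (hK : ∀ x, ‖A x‖ ≤ K) (hA : Tendsto A atBot (𝓝 Ainf))
    (h : IsCompl (decayingData (expFlow Ainf) atBot) (decayingData (expFlow Ainf) atTop)) :
    Module.finrank ℝ (decayingData U atBot)
      = Module.finrank ℝ (decayingData (expFlow Ainf) atBot) := by
  obtain ⟨H, κ, hH⟩ := exists_isAdapted h one_pos
  have hadd := Submodule.finrank_add_eq_of_isCompl h
  -- `U x` is injective, hence preserves dimensions
  have hrank : ∀ (x : ℝ) (W : Submodule ℝ E),
      Module.finrank ℝ (W.map (U x : E →ₗ[ℝ] E)) = Module.finrank ℝ W := fun x W =>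
    (W.equivMapOfInjective (U x : E →ₗ[ℝ] E) (hU.injective hK x)).symm.finrank_eq
  apply le_antisymm
  · obtain ⟨x, hx⟩ := (hH.eventually_nonneg_atBot hU hA).exists
    have hdisj : Disjoint ((decayingData U atBot).map (U x : E →ₗ[ℝ] E))
        (decayingData (expFlow Ainf) atTop) := by
      refine Submodule.disjoint_def.2 ?_
      rintro _ ⟨c, hc, rfl⟩ hs
      exact hH.eq_zero _ hs (hx c hc)
    have h1 := Submodule.finrank_add_finrank_le_of_disjoint hdisj
    rw [hrank] at h1
    omega
  · obtain ⟨W, hW⟩ := (decayingData U atBot).exists_isCompl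
    obtain ⟨X, hX⟩ := hH.exists_strictLyapunov_reverse hA
    have hWd : Disjoint W (decayingData (fun x => U (-x)) atTop) := by
      rw [decayingData_reverse]
      exact hW.symm.disjoint
    obtain ⟨x, hx⟩ := (hX.eventually_pos hU.reverse (K := K) (fun x => by simpa using hK (-x))
      (half_pos hH.pos) hWd).exists
    have hdisj : Disjoint (W.map (U (-x) : E →ₗ[ℝ] E)) (decayingData (expFlow Ainf) atBot) := by
      refine Submodule.disjoint_def.2 ?_
      rintro _ ⟨c, hc, rfl⟩ hu
      by_contra hne
      have hc0 : c ≠ 0 := by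
        rintro rfl
        simp at hne
      have h1 := hx c hc hc0
      have h2 := hH.nonneg _ hu
      simp only [neg_apply, inner_neg_right, ContinuousLinearMap.coe_coe] at h1 h2
      linarith
    have h1 := Submodule.finrank_add_finrank_le_of_disjoint hdisj
    have h2 := Submodule.finrank_add_eq_of_isCompl hW
    rw [hrank] at h1
    omega

/-- Along every filter for which the unstable space enters the nonnegative cones of all adapted
forms, it converges to the asymptotic unstable space and becomes transversal to the asymptotic
stable space. -/
theorem tendsto_starProjection_map {A U : ℝ → E →L[ℝ] E} {Ainf : E →L[ℝ] E} {K : ℝ}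
    (hU : IsFundamental A U) (hK : ∀ x, ‖A x‖ ≤ K) (hbot : Tendsto A atBot (𝓝 Ainf))
    (h : IsCompl (decayingData (expFlow Ainf) atBot) (decayingData (expFlow Ainf) atTop))
    {l : Filter ℝ} (hl : ∀ H κ ε, IsAdapted Ainf H κ ε →
      ∀ᶠ x in l, ∀ c ∈ decayingData U atBot, 0 ≤ inner ℝ (U x c) (H (U x c))) :
    Tendsto (fun x => ((decayingData U atBot).map (U x : E →ₗ[ℝ] E)).starProjection) l
        (𝓝 (decayingData (expFlow Ainf) atBot).starProjection) ∧
      ∀ᶠ x in l, Disjoint ((decayingData U atBot).map (U x : E →ₗ[ℝ] E))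
        (decayingData (expFlow Ainf) atTop) := by
  constructor
  · refine tendsto_starProjection (fun x => ?_) fun ε hε => ?_
    · rw [← finrank_decayingData_atBot hU hK hbot h]
      exact ((decayingData U atBot).equivMapOfInjective (U x : E →ₗ[ℝ] E)
        (hU.injective hK x)).symm.finrank_eq
    · obtain ⟨H, κ, hH⟩ := exists_isAdapted h hε
      filter_upwards [hl H κ ε hH] with x hx
      rintro _ ⟨c, hc, rfl⟩
      exact hH.close _ (hx c hc)
  · obtain ⟨H, κ, hH⟩ := exists_isAdapted h one_pos
    filter_upwards [hl H κ 1 hH] with x hx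
    refine Submodule.disjoint_def.2 ?_
    rintro _ ⟨c, hc, rfl⟩ hs
    exact hH.eq_zero _ hs (hx c hc)

end Asymptotics

theorem exists_bound_of_tendsto {F : Type*} [NormedAddCommGroup F] {f : ℝ → F} {a b : F}
    (hf : Continuous f) (hbot : Tendsto f atBot (𝓝 a)) (htop : Tendsto f atTop (𝓝 b)) :
    ∃ K, ∀ x, ‖f x‖ ≤ K := by
  obtain ⟨m, hm⟩ := eventually_atBot.1 (hbot.norm.eventually_le_const (lt_add_one ‖a‖))
  obtain ⟨M, hM⟩ := eventually_atTop.1 (htop.norm.eventually_le_const (lt_add_one ‖b‖))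
  obtain ⟨C, hC⟩ := isCompact_Icc.exists_bound_of_continuousOn (s := Set.Icc m M) hf.continuousOn
  refine ⟨max C (max (‖a‖ + 1) (‖b‖ + 1)), fun x => ?_⟩
  rcases le_total x m with h1 | h1
  · exact (hm x h1).trans (by simp)
  · rcases le_total M x with h2 | h2
    · exact (hM x h2).trans (by simp)
    · exact (hC x ⟨h1, h2⟩).trans (by simp)

/-! ### Isotropy of decaying solutions -/

section Symplectic

theorem continuous_op_hamMatrix : Continuous fun M : Mat4 => op (hamMatrix M) := by
  have h1 : Continuous (fun M : Mat4 => op M) :=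
    LinearMap.continuous_of_finiteDimensional
      ((Matrix.toEuclideanCLM (n := Fin 2 ⊕ Fin 2) (𝕜 := ℝ)).toAlgEquiv.toLinearMap)
  exact h1.comp (continuous_const.matrix_mul continuous_id)

theorem inner_op_left (M : Mat4) (a b : Phase) :
    inner ℝ (op M a) b = inner ℝ a (op M.transpose b) := by
  rw [real_inner_comm]
  simp only [op]
  rw [Matrix.inner_toEuclideanCLM, Matrix.inner_toEuclideanCLM, Matrix.dotProduct_mulVec,
    Matrix.mulVec_transpose, dotProduct_comm]

/-- The symplectic form `⟪a, J b⟫`. -/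
noncomputable def symplecticForm (a b : Phase) : ℝ := inner ℝ a (op (Matrix.J (Fin 2) ℝ) b)

theorem op_J_op_hamMatrix (M : Mat4) (a : Phase) :
    op (Matrix.J (Fin 2) ℝ) (op (hamMatrix M) a) = op M a := by
  have h : op (Matrix.J (Fin 2) ℝ) * op (hamMatrix M) = op M := by
    simp only [op, hamMatrix]
    rw [← map_mul, ← mul_assoc, Matrix.mul_nonsing_inv _ (Matrix.isUnit_det_J (Fin 2) ℝ), one_mul]
  exact DFunLike.congr_fun h a

theorem symplecticForm_hamMatrix_right (M : Mat4) (a b : Phase) :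
    symplecticForm a (op (hamMatrix M) b) = inner ℝ a (op M b) := by
  rw [symplecticForm, op_J_op_hamMatrix]

theorem symplecticForm_hamMatrix_left {M : Mat4} (hM : M.IsSymm) (a b : Phase) :
    symplecticForm (op (hamMatrix M) a) b = -inner ℝ a (op M b) := by
  have h1 : ∀ c d : Phase, symplecticForm c d = -inner ℝ (op (Matrix.J (Fin 2) ℝ) c) d := by
    intro c d
    rw [inner_op_left, Matrix.J_transpose, symplecticForm]
    simp [op]
  rw [h1, op_J_op_hamMatrix, inner_op_left, hM.eq]

/-- The decaying orbits of a linear Hamiltonian system form an isotropic space: the symplectic form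
of two solutions is constant, and it tends to `0`. -/
theorem symplecticForm_eq_zero {B : ℝ → Mat4} (hB : ∀ x, (B x).IsSymm) {U : ℝ → Phase →L[ℝ] Phase}
    (hU : IsFundamental (fun x => op (hamMatrix (B x))) U) {l : Filter ℝ} [l.NeBot] {c d : Phase}
    (hc : c ∈ decayingData U l) (hd : d ∈ decayingData U l) (x : ℝ) :
    symplecticForm (U x c) (U x d) = 0 := by
  have hder : ∀ y, HasDerivAt (fun y => symplecticForm (U y c) (U y d)) 0 y := by
    intro y
    have h1 := (hU.hasDerivAt_apply c y).inner ℝ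
      ((op (Matrix.J (Fin 2) ℝ)).hasFDerivAt.comp_hasDerivAt y (hU.hasDerivAt_apply d y))
    have h2 := symplecticForm_hamMatrix_right (B y) (U y c) (U y d)
    have h3 := symplecticForm_hamMatrix_left (hB y) (U y c) (U y d)
    have h4 := add_neg_cancel (inner ℝ (U y c) (op (B y) (U y d)))
    rw [← h3] at h4
    nth_rewrite 1 [← h2] at h4
    exact h4 ▸ h1
  have hconst : ∀ y, symplecticForm (U y c) (U y d) = symplecticForm (U x c) (U x d) := fun y =>
    is_const_of_deriv_eq_zero (fun y => (hder y).differentiableAt) (fun y => (hder y).deriv) y x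
  have hlim : Tendsto (fun y => symplecticForm (U y c) (U y d)) l (𝓝 0) := by
    simpa [symplecticForm] using (mem_decayingData.1 hc).inner (𝕜 := ℝ)
      (((op (Matrix.J (Fin 2) ℝ)).continuous.tendsto 0).comp (mem_decayingData.1 hd))
  simp only [hconst] at hlim
  exact tendsto_nhds_unique tendsto_const_nhds hlim

end Symplectic

/-! ### Crossings -/

section Crossings

/-- `Eᵘ(x)` and `Eˢ(x)` are transported by the fundamental solution. -/
theorem decaySpace_eq_map {B : ℝ → Mat4} {U : ℝ → Phase →L[ℝ] Phase}
    (hU : IsFundamental (fun x => op (hamMatrix (B x))) U) {K : ℝ}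
    (hK : ∀ x, ‖op (hamMatrix (B x))‖ ≤ K) (l : Filter ℝ) (x : ℝ) :
    decaySpace B l x = (decayingData U l).map (U x : Phase →ₗ[ℝ] Phase) := by
  ext p
  constructor
  · rintro ⟨u, hu, rfl, hul⟩
    have h := hU.eq_apply hK hu
    exact ⟨u 0, by rw [h] at hul; exact hul, (congrFun h x).symm⟩
  · rintro ⟨c, hc, rfl⟩
    exact ⟨fun y => U y c, hU.hasDerivAt_apply c, rfl, hc⟩

/-- `A∞` has no imaginary eigenvalue, hence the space splits. -/
theorem isCompl_asymptotic {Binf : ℝ → Mat4} {lam : ℝ} (h : lam ∉ essentialSpectrum Binf) :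
    IsCompl (asymptoticUnstable (Binf lam)) (asymptoticStable (Binf lam)) := by
  refine ⟨disjoint_decayingData_expFlow _, codisjoint_iff.2 ?_⟩
  exact sup_decayingData_expFlow _ fun κ hκ => h ⟨κ, hκ⟩

/-- Regular crossings do not accumulate. If crossings `xₙ → x₀` are given, with
`ξₙ = U(xₙ) cₙ → ξ = U(x₀) c`, then `ξₙ` is symplectically orthogonal to `U(xₙ) c`, as both lie in
the isotropic space `Eᵘ(xₙ)`, and to `ξ`, as both lie in the isotropic space `Eˢ∞`. Dividing by
`xₙ - x₀` and passing to the limit makes the crossing form vanish at `ξ`. -/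
theorem crossings_finite {B : ℝ → Mat4} {Binf : Mat4} (hB : ∀ x, (B x).IsSymm)
    (hBinf : Binf.IsSymm) {U : ℝ → Phase →L[ℝ] Phase}
    (hU : IsFundamental (fun x => op (hamMatrix (B x))) U) {K : ℝ}
    (hK : ∀ x, ‖op (hamMatrix (B x))‖ ≤ K) {R : ℝ} (hR : crossings B Binf ⊆ Set.Icc (-R) R)
    (hreg : ∀ x ∈ crossings B Binf, IsRegularCrossing B Binf x) : (crossings B Binf).Finite := by
  by_contra hinf
  obtain ⟨x₀, -, hacc⟩ := Set.Infinite.exists_accPt_of_subset_isCompact hinf isCompact_Icc hR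
  rw [accPt_iff_frequently_nhdsNE] at hacc
  obtain ⟨x, hxlim, hx⟩ := exists_seq_forall_of_frequently hacc
  have hmem : ∀ n, ∃ c ∈ decayingData U atBot, ‖c‖ = 1 ∧ U (x n) c ∈ asymptoticStable Binf := by
    intro n
    obtain ⟨p, hp, hp0⟩ := Submodule.exists_mem_ne_zero_of_ne_bot (hx n)
    obtain ⟨hpu, hps⟩ := Submodule.mem_inf.1 hp
    rw [unstableSpace, decaySpace_eq_map hU hK] at hpu
    obtain ⟨c, hc, rfl⟩ := hpu
    have hc0 : c ≠ 0 := by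
      rintro rfl
      simp at hp0
    refine ⟨‖c‖⁻¹ • c, Submodule.smul_mem _ _ hc, ?_, ?_⟩
    · rw [norm_smul, norm_inv, norm_norm, inv_mul_cancel₀ (norm_ne_zero_iff.2 hc0)]
    · rw [map_smul]
      exact Submodule.smul_mem _ _ hps
  choose c hc hc1 hcs using hmem
  -- normalising the initial values `cₙ`, rather than `ξₙ`, makes `ξ = U(x₀) c ≠ 0` automatic
  obtain ⟨c₀, hc₀, φ, hφ, hφlim⟩ := (isCompact_sphere (0 : Phase) 1).tendsto_subseq
    (x := c) (fun n => by simp [hc1 n])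
  have hxφ : Tendsto (fun n => x (φ n)) atTop (𝓝[≠] x₀) := hxlim.comp hφ.tendsto_atTop
  have hxφ' : Tendsto (fun n => x (φ n)) atTop (𝓝 x₀) := hxφ.mono_right nhdsWithin_le_nhds
  have hUlim : Tendsto (fun n => U (x (φ n))) atTop (𝓝 (U x₀)) :=
    (hU.continuous.tendsto x₀).comp hxφ'
  have hξlim : Tendsto (fun n => U (x (φ n)) (c (φ n))) atTop (𝓝 (U x₀ c₀)) :=
    ((isBoundedBilinearMap_apply (𝕜 := ℝ) (E := Phase) (F := Phase)).continuous.tendsto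
      (U x₀, c₀)).comp (hUlim.prodMk_nhds hφlim)
  have hc₀u : c₀ ∈ decayingData U atBot :=
    (decayingData U atBot).closed_of_finiteDimensional.mem_of_tendsto hφlim
      (.of_forall fun n => hc (φ n))
  have hξs : U x₀ c₀ ∈ asymptoticStable Binf :=
    (asymptoticStable Binf).closed_of_finiteDimensional.mem_of_tendsto hξlim
      (.of_forall fun n => hcs (φ n))
  have hξu : U x₀ c₀ ∈ unstableSpace B x₀ := by
    rw [unstableSpace, decaySpace_eq_map hU hK]
    exact ⟨c₀, hc₀u, rfl⟩
  have hξ0 : U x₀ c₀ ≠ 0 := by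
    intro h0
    have h1 : c₀ = 0 := hU.injective hK x₀ (by rw [h0, map_zero])
    simp [h1] at hc₀
  have hξc : U x₀ c₀ ∈ crossingSpace B Binf x₀ := ⟨hξu, hξs⟩
  have hcross : x₀ ∈ crossings B Binf := fun hbot => by
    rw [hbot] at hξc
    exact hξ0 (by simpa using hξc)
  refine (hreg x₀ hcross).2 _ hξc hξ0 ?_
  have hslope := (hasDerivAt_iff_tendsto_slope.1 (hU.hasDerivAt_apply c₀ x₀)).comp hxφ
  have hlim : Tendsto (fun n => symplecticForm (U (x (φ n)) (c (φ n)))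
      (slope (fun y => U y c₀) x₀ (x (φ n)))) atTop
      (𝓝 (symplecticForm (U x₀ c₀) (op (hamMatrix (B x₀)) (U x₀ c₀)))) :=
    hξlim.inner (((op (Matrix.J (Fin 2) ℝ)).continuous.tendsto _).comp hslope)
  have hzero : ∀ n, symplecticForm (U (x (φ n)) (c (φ n)))
      (slope (fun y => U y c₀) x₀ (x (φ n))) = 0 := by
    intro n
    have h1 := symplecticForm_eq_zero hB hU (hc (φ n)) hc₀u (x (φ n))
    have h2 := symplecticForm_eq_zero (fun _ => hBinf) (isFundamental_expFlow (op (hamMatrix Binf)))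
      (hcs (φ n)) hξs 0
    rw [expFlow_zero, one_apply_eq_self, one_apply_eq_self] at h2
    simp only [symplecticForm] at h1 h2 ⊢
    rw [slope_def_module, map_smul, map_sub, inner_smul_right, inner_sub_right, h1, h2]
    simp
  simp only [hzero] at hlim
  rw [symplecticForm_hamMatrix_right] at hlim
  exact tendsto_nhds_unique hlim tendsto_const_nhds

theorem sign_crossingForm_smul (B : ℝ → Mat4) (x : ℝ) (ξ : Phase) {a : ℝ} (ha : a ≠ 0) :
    SignType.sign (crossingForm B x (a • ξ)) = SignType.sign (crossingForm B x ξ) := by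
  have h : crossingForm B x (a • ξ) = a ^ 2 * crossingForm B x ξ := by
    simp only [crossingForm, map_smul, inner_smul_left, inner_smul_right, conj_trivial]
    ring
  rw [h, sign_mul, sign_pos (by positivity), one_mul]

theorem existsUnique_isMaslovIndex {B : ℝ → Mat4} {Binf : Mat4} (hfin : (crossings B Binf).Finite)
    (hreg : ∀ x ∈ crossings B Binf, IsRegularCrossing B Binf x) :
    ∃! m : ℤ, IsMaslovIndex B Binf m := by
  have hex : ∀ x, ∃ ξ : Phase, x ∈ crossings B Binf →
      ξ ≠ 0 ∧ Submodule.span ℝ {ξ} = crossingSpace B Binf x := by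
    intro x
    by_cases hx : x ∈ crossings B Binf
    · obtain ⟨ξ, hξ⟩ := finrank_eq_one_iff'.1 (hreg x hx).1
      obtain ⟨hξ0, hspan⟩ := hξ
      refine ⟨ξ, fun _ => ⟨fun h => hξ0 (Subtype.ext h), le_antisymm ?_ fun p hp => ?_⟩⟩
      · rw [Submodule.span_singleton_le_iff_mem]
        exact ξ.2
      · obtain ⟨a, ha⟩ := hspan ⟨p, hp⟩
        exact Submodule.mem_span_singleton.2 ⟨a, congrArg Subtype.val ha⟩
    · exact ⟨0, fun h => absurd h hx⟩
  choose ξ hξ using hex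
  refine ⟨_, ⟨hfin, ξ, hξ, rfl⟩, ?_⟩
  rintro m ⟨_, η, hη, rfl⟩
  refine Finset.sum_congr rfl fun x hx => ?_
  have hx' : x ∈ crossings B Binf := by simpa using hx
  obtain ⟨hη0, hηs⟩ := hη x hx'
  have hmem : η x ∈ Submodule.span ℝ {ξ x} := by
    rw [(hξ x hx').2, ← hηs]
    exact Submodule.mem_span_singleton_self _
  obtain ⟨a, ha⟩ := Submodule.mem_span_singleton.1 hmem
  have ha0 : a ≠ 0 := by
    rintro rfl
    exact hη0 (by rw [← ha, zero_smul])
  rw [← ha, sign_crossingForm_smul B x _ ha0]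

end Crossings

end SolitaryMaslov

theorem mainTheorem1
    (B : ℝ → ℝ → SolitaryMaslov.Mat4) (Binf : ℝ → SolitaryMaslov.Mat4)
    (hsymm : ∀ x lam, (B x lam).IsSymm)
    (hsmooth : ∀ i j, ContDiff ℝ ∞ (fun p : ℝ × ℝ => B p.1 p.2 i j))
    (htop : ∀ lam, Tendsto (fun x => B x lam) atTop (𝓝 (Binf lam)))
    (hbot : ∀ lam, Tendsto (fun x => B x lam) atBot (𝓝 (Binf lam)))
    (lam : ℝ)
    (hess : lam ∉ SolitaryMaslov.essentialSpectrum Binf)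
    (heig : ¬ SolitaryMaslov.IsEigenvalue B lam) :
    (IsCompl (SolitaryMaslov.asymptoticUnstable (Binf lam))
        (SolitaryMaslov.asymptoticStable (Binf lam)) ∧
      Tendsto (fun x => (SolitaryMaslov.unstableSpace (fun y => B y lam) x).starProjection)
        atBot (𝓝 (SolitaryMaslov.asymptoticUnstable (Binf lam)).starProjection) ∧
      Tendsto (fun x => (SolitaryMaslov.unstableSpace (fun y => B y lam) x).starProjection)
        atTop (𝓝 (SolitaryMaslov.asymptoticUnstable (Binf lam)).starProjection) ∧
      ∃ R : ℝ, SolitaryMaslov.crossings (fun y => B y lam) (Binf lam) ⊆ Set.Icc (-R) R) ∧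
    ((∀ x ∈ SolitaryMaslov.crossings (fun y => B y lam) (Binf lam),
        SolitaryMaslov.IsRegularCrossing (fun y => B y lam) (Binf lam) x) →
      (SolitaryMaslov.crossings (fun y => B y lam) (Binf lam)).Finite ∧
      ∃! m : ℤ, SolitaryMaslov.IsMaslovIndex (fun y => B y lam) (Binf lam) m) := by
  open SolitaryMaslov in
  have hBc : Continuous fun x => B x lam :=
    continuous_matrix fun i j => (hsmooth i j).continuous.comp (by fun_prop :
      Continuous fun x : ℝ => (x, lam))
  have hAc := continuous_op_hamMatrix.comp hBc
  have hAtop := (continuous_op_hamMatrix.tendsto _).comp (htop lam)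
  have hAbot := (continuous_op_hamMatrix.tendsto _).comp (hbot lam)
  obtain ⟨K, hK⟩ := exists_bound_of_tendsto hAc hAbot hAtop
  obtain ⟨U, hU⟩ := exists_isFundamental hAc hK
  have hcompl := isCompl_asymptotic hess
  -- at `x = 0`, where `U 0 = 1`, the two spaces of initial values are `Eᵘ(0)` and `Eˢ(0)`
  have hdata : Disjoint (decayingData U atBot) (decayingData U atTop) := by
    refine Submodule.disjoint_def.2 fun c hcu hcs => ?_
    by_contra hc0
    refine heig ⟨0, fun h => hc0 ?_⟩
    have h1 : U 0 c ∈ (⊥ : Submodule ℝ Phase) := by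
      rw [← h, stableSpace, unstableSpace, decaySpace_eq_map hU hK, decaySpace_eq_map hU hK]
      exact ⟨⟨c, hcs, rfl⟩, ⟨c, hcu, rfl⟩⟩
    simpa [hU.zero] using h1
  obtain ⟨hlimbot, htrbot⟩ := tendsto_starProjection_map hU hK hAbot hcompl
    (fun H κ ε hH => hH.eventually_nonneg_atBot hU hAbot)
  obtain ⟨hlimtop, htrtop⟩ := tendsto_starProjection_map hU hK hAbot hcompl
    (fun H κ ε hH => hH.eventually_nonneg_atTop hU hK hAtop hdata)
  have hE : ∀ x, unstableSpace (fun y => B y lam) x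
      = (decayingData U atBot).map (U x : Phase →ₗ[ℝ] Phase) := decaySpace_eq_map hU hK atBot
  have hbounded : ∃ R : ℝ, crossings (fun y => B y lam) (Binf lam) ⊆ Set.Icc (-R) R := by
    obtain ⟨m, hm⟩ := eventually_atBot.1 htrbot
    obtain ⟨M, hM⟩ := eventually_atTop.1 htrtop
    have hno : ∀ x, Disjoint ((decayingData U atBot).map (U x : Phase →ₗ[ℝ] Phase))
        (asymptoticStable (Binf lam)) → x ∉ crossings (fun y => B y lam) (Binf lam) := by
      intro x hx hcr
      refine hcr ?_
      rw [crossingSpace, hE]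
      exact hx.eq_bot
    refine ⟨max (-m) M, fun x hx => ⟨?_, ?_⟩⟩
    · by_contra hlt
      exact hno x (hm x (by linarith [le_max_left (-m) M])) hx
    · by_contra hlt
      exact hno x (hM x (by linarith [le_max_right (-m) M])) hx
  have hBinf : (Binf lam).IsSymm := by
    have h1 := (continuous_id.matrix_transpose.tendsto (Binf lam)).comp (htop lam)
    refine tendsto_nhds_unique (h1.congr fun x => ?_) (htop lam)
    exact hsymm x lam
  refine ⟨⟨hcompl, ?_, ?_, hbounded⟩, fun hreg => ?_⟩
  · simp only [hE]
    exact hlimbot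
  · simp only [hE]
    exact hlimtop
  · obtain ⟨R, hR⟩ := hbounded
    have hfin := crossings_finite (fun x => hsymm x lam) hBinf hU hK hR hreg
    exact ⟨hfin, existsUnique_isMaslovIndex hfin hreg⟩
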